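/- Let $K$ be a field of characteristic $0$ (for instance $\mathbb R$). Let $\mathcal H_{CM}$ be the Connes–Moscovici Hopf algebra over $K$: as an algebra it is the enveloping algebra of the Lie algebra with basis $Y, X, \delta_1,\delta_2,\dots$ and brackets $$[Y,X]=X,\quad [Y,\delta_n]=n\,\delta_n,\quad [X,\delta_n]=\delta_{n+1},\quad [\delta_n,\delta_m]=0 \qquad (m,n\ge 1),$$ and its coproduct is the algebra homomorphism with $$\Delta(Y)=Y\otimes 1+1\otimes Y,\quad \Delta(X)=X\otimes 1+1\otimes X+\delta_1\otimes Y,\quad \Delta(\delta_1)=\delta_1\otimes 1+1\otimes\delta_1 .$$ Let $\mathcal H^1_{CM}\subset\mathcal H_{CM}$ be the Hopf subalgebra generated by the $\delta_n$, $n\ge1$, and $S$ its antipode. For a tuple $\mathbf n=(n_1,\dots,n_s)$ of positive integers ($s\ge1$) put $l(\mathbf n)=s$ and $\|\mathbf n\|=n_1+\dots+n_s$; write $\sum_{\mathbf n^1\cdots\mathbf n^t=\mathbf n}$ for the sum over all ways to write $\mathbf n$ as the concatenation of $t$ nonempty tuples $\mathbf n^1,\dots,\mathbf n^t$. Put $$A(\mathbf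 n^1,\dots,\mathbf n^t)=\frac1{l(\mathbf n^1)!\cdots l(\mathbf n^t)!}\prod_{i=1}^t\frac1{\|\mathbf n^i\|+1},$$ and, for $k\ge 1$, $$B_k(\mathbf n^1,\dots,\mathbf n^t)=\binom{k}{l(\mathbf n^t)}\prod_{i=1}^{t-1}\binom{\|\mathbf n^{i+1}\|+\dots+\|\mathbf n^t\|+k}{l(\mathbf n^i)},$$ $$U^{\mathbf m}_k=\sum_{i=1}^{l(\mathbf m)}(-1)^{i-1}\sum_{\mathbf m^1\cdots\mathbf m^i=\mathbf m}B_k(\mathbf m^1,\dots,\mathbf m^i),$$ where $\binom ab=0$ if $b>a$. Theorem. For every $n\ge1$, $$S(\delta_n)=\sum_{\substack{(n_1,\dots,n_s),\ s\ge1,\ n_i\ge 1\\ n_1+\dots+n_s=n}}\frac{n!}{n_1!\cdots n_s!}\,\beta^{n_1,\dots,n_s}\,\delta_{n_1}\cdots\delta_{n_s},$$ where $\beta^{n_1}=-1$ and, for $s\ge1$ and positive integers $n_1,\dots,n_{s+1}$, $$\beta^{n_1,\dots,n_s,n_{s+1}}=\sum_{t=1}^{s}\ \sum_{\mathbf n^1\cdots\mathbf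 n^t=(n_1,\dots,n_s)}U^{\|\mathbf n^1\|,\dots,\|\mathbf n^t\|}_{n_{s+1}}\,A(\mathbf n^1,\dots,\mathbf n^t).$$ -/

import Mathlib

namespace ConnesMoscovici

/-! ### The Connes-Moscovici Lie algebra -/

section LieAlgebra

attribute [local instance] LieRing.ofAssociativeRing

/-- The underlying vector space of the Connes-Moscovici Lie algebra, with basis
`Y`, `X`, `δ₁, δ₂, …`: the element `⟨a, b, d⟩` stands for `a Y + b X + ∑ᵢ dᵢ δᵢ₊₁`. -/
@[ext]
structure CMLie (k : Type*) [Field k] where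
  y : k
  x : k
  d : ℕ →₀ k

variable (k : Type*) [Field k]

/-- `CMLie k` as a product, used only to transport the vector space structure. -/
def CMLie.equivProd : CMLie k ≃ k × k × (ℕ →₀ k) where
  toFun u := (u.y, u.x, u.d)
  invFun p := ⟨p.1, p.2.1, p.2.2⟩
  left_inv _ := rfl
  right_inv _ := rfl

noncomputable instance : AddCommGroup (CMLie k) := (CMLie.equivProd k).addCommGroup
noncomputable instance : Module k (CMLie k) := (CMLie.equivProd k).module k

variable {k}

@[simp] theorem CMLie.zero_y : (0 : CMLie k).y = 0 := rfl
@[simp] theorem CMLie.zero_x : (0 : CMLie k).x = 0 := rfl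
@[simp] theorem CMLie.zero_d : (0 : CMLie k).d = 0 := rfl
@[simp] theorem CMLie.add_y (u v : CMLie k) : (u + v).y = u.y + v.y := rfl
@[simp] theorem CMLie.add_x (u v : CMLie k) : (u + v).x = u.x + v.x := rfl
@[simp] theorem CMLie.add_d (u v : CMLie k) : (u + v).d = u.d + v.d := rfl
@[simp] theorem CMLie.smul_y (c : k) (u : CMLie k) : (c • u).y = c * u.y := rfl
@[simp] theorem CMLie.smul_x (c : k) (u : CMLie k) : (c • u).x = c * u.x := rfl
@[simp] theorem CMLie.smul_d (c : k) (u : CMLie k) : (c • u).d = c • u.d := rfl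

variable (k)

/-- The linear map `δₙ ↦ δₙ₊₁`, the action of `X`. -/
noncomputable def shift : (ℕ →₀ k) →ₗ[k] (ℕ →₀ k) :=
  Finsupp.linearCombination k fun i => Finsupp.single (i + 1) 1

/-- The linear map `δₙ ↦ n δₙ`, the action of `Y`. -/
noncomputable def grade : (ℕ →₀ k) →ₗ[k] (ℕ →₀ k) :=
  Finsupp.linearCombination k fun i => ((i : k) + 1) • Finsupp.single i 1

theorem grade_shift (d : ℕ →₀ k) : grade k (shift k d) = shift k (grade k d) + shift k d := by
  induction d using Finsupp.induction_linear with
  | zero => simp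
  | add f g hf hg => simp only [map_add, hf, hg]; abel
  | single i a =>
    simp only [grade, shift, Finsupp.linearCombination_single, map_smul, one_smul]
    push_cast
    module

/-- The Lie bracket with `[Y, X] = X`, `[Y, δₙ] = n δₙ`, `[X, δₙ] = δₙ₊₁`, `[δₙ, δₘ] = 0`. -/
noncomputable instance : Bracket (CMLie k) (CMLie k) where
  bracket u v := ⟨0, u.y * v.x - u.x * v.y,
    u.y • grade k v.d - v.y • grade k u.d + (u.x • shift k v.d - v.x • shift k u.d)⟩

variable {k}
theorem CMLie.lie_def (u v : CMLie k) : ⁅u, v⁆ = ⟨0, u.y * v.x - u.x * v.y,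
    u.y • grade k v.d - v.y • grade k u.d + (u.x • shift k v.d - v.x • shift k u.d)⟩ := rfl
variable (k)

noncomputable instance : LieRing (CMLie k) where
  add_lie u v w := by
    ext1 <;> simp only [CMLie.lie_def, CMLie.add_y, CMLie.add_x, CMLie.add_d, map_add]
    · simp
    · ring
    · module
  lie_add u v w := by
    ext1 <;> simp only [CMLie.lie_def, CMLie.add_y, CMLie.add_x, CMLie.add_d, map_add]
    · simp
    · ring
    · module
  lie_self u := by
    ext1 <;> simp [CMLie.lie_def, mul_comm]
  leibniz_lie u v w := by
    ext1 <;> simp only [CMLie.lie_def, CMLie.add_y, CMLie.add_x, CMLie.add_d, map_add, map_sub,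
      map_smul, grade_shift]
    · simp
    · ring
    · module

noncomputable instance : LieAlgebra k (CMLie k) where
  lie_smul c u v := by
    ext1 <;> simp only [CMLie.lie_def, CMLie.smul_y, CMLie.smul_x, CMLie.smul_d, map_smul]
    · simp
    · ring
    · module

/-- The basis elements of the Lie algebra (`lieδ k n` is `δₙ` for `n ≥ 1`; `n = 0` is not used). -/
noncomputable def lieY : CMLie k := ⟨1, 0, 0⟩
noncomputable def lieX : CMLie k := ⟨0, 1, 0⟩
noncomputable def lieδ (n : ℕ) : CMLie k := if n = 0 then 0 else ⟨0, 0, Finsupp.single (n - 1) 1⟩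

theorem lieδ_succ (n : ℕ) : lieδ k (n + 1) = ⟨0, 0, Finsupp.single n 1⟩ := by simp [lieδ]

theorem lie_Y_X : ⁅lieY k, lieX k⁆ = lieX k := by
  ext1 <;> simp [CMLie.lie_def, lieX, lieY]

theorem lie_X_δ (n : ℕ) : ⁅lieX k, lieδ k (n + 1)⁆ = lieδ k (n + 2) := by
  ext1 <;> simp [CMLie.lie_def, lieX, lieδ, shift]

theorem lie_Y_δ (n : ℕ) : ⁅lieY k, lieδ k n⁆ = (n : k) • lieδ k n := by
  rcases n with _ | n
  · simp [lieδ]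
  · ext1 <;> simp [CMLie.lie_def, lieY, lieδ, grade]

theorem lie_δ_δ (n m : ℕ) : ⁅lieδ k n, lieδ k m⁆ = 0 := by
  rcases n with _ | n
  · simp [lieδ]
  rcases m with _ | m
  · simp [lieδ]
  ext1 <;> simp [CMLie.lie_def, lieδ]

theorem CMLie.eq_sum (u : CMLie k) : u = u.y • lieY k + u.x • lieX k +
    u.d.sum fun i c => c • lieδ k (i + 1) := by
  let L : (ℕ →₀ k) →ₗ[k] CMLie k :=
    { toFun := fun d => ⟨0, 0, d⟩
      map_add' := fun a b => by ext1 <;> simp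
      map_smul' := fun a b => by ext1 <;> simp }
  have h : (u.d.sum fun i c => c • lieδ k (i + 1)) = L u.d := by
    conv_rhs => rw [← Finsupp.sum_single u.d, map_finsuppSum]
    refine Finsupp.sum_congr fun i _ => ?_
    ext1 <;> simp [lieδ_succ, L]
  rw [h]
  ext1 <;> simp [lieX, lieY, L]

variable {k}

/-- A Lie homomorphism out of the Lie algebra, from the images of the basis elements. -/
noncomputable def lieLift {A : Type*} [Ring A] [Algebra k A] (Y X : A)
    (D : ℕ → A) (hYX : ⁅Y, X⁆ = X) (hXD : ∀ n, ⁅X, D n⁆ = D (n + 1))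
    (hYD : ∀ n, ⁅Y, D n⁆ = ((n : k) + 1) • D n) (hDD : ∀ n m, ⁅D n, D m⁆ = 0) :
    CMLie k →ₗ⁅k⁆ A where
  toFun u := u.y • Y + u.x • X + Finsupp.linearCombination k D u.d
  map_add' u v := by simp only [CMLie.add_y, CMLie.add_x, CMLie.add_d, map_add]; module
  map_smul' c u := by
    simp only [CMLie.smul_y, CMLie.smul_x, CMLie.smul_d, map_smul, RingHom.id_apply]; module
  map_lie' {u v} := by
    set φ := Finsupp.linearCombination k D with hφ
    have h1 : ∀ d, φ (shift k d) = ⁅X, φ d⁆ := fun d => by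
      induction d using Finsupp.induction_linear with
      | zero => simp
      | add f g hf hg => simp only [map_add, hf, hg, lie_add]
      | single i a => simp [hφ, shift, hXD]
    have h2 : ∀ d, φ (grade k d) = ⁅Y, φ d⁆ := fun d => by
      induction d using Finsupp.induction_linear with
      | zero => simp
      | add f g hf hg => simp only [map_add, hf, hg, lie_add]
      | single i a =>
        simp only [hφ, grade, Finsupp.linearCombination_single, map_smul, one_smul, lie_smul, hYD]
    have h3 : ∀ d e, ⁅φ d, φ e⁆ = 0 := fun d e => by
      induction d using Finsupp.induction_linear with
      | zero => simp
      | add f g hf hg => simp only [map_add, hf, hg, add_lie, add_zero]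
      | single i a =>
        induction e using Finsupp.induction_linear with
        | zero => simp
        | add f g hf hg => simp only [map_add, hf, hg, lie_add, add_zero]
        | single j b => simp [hφ, hDD]
    have ls : ∀ (c : k) (a b : A), ⁅a, c • b⁆ = c • ⁅a, b⁆ := fun c a b => lie_smul c a b
    have hXY : ⁅X, Y⁆ = -X := by rw [← lie_skew, hYX]
    have h4 : ∀ d, ⁅φ d, X⁆ = -⁅X, φ d⁆ := fun d => by rw [lie_skew]
    have h5 : ∀ d, ⁅φ d, Y⁆ = -⁅Y, φ d⁆ := fun d => by rw [lie_skew]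
    change (0 : k) • Y + (u.y * v.x - u.x * v.y) • X + φ (u.y • grade k v.d - v.y • grade k u.d +
        (u.x • shift k v.d - v.x • shift k u.d)) =
      ⁅u.y • Y + u.x • X + φ u.d, v.y • Y + v.x • X + φ v.d⁆
    simp only [map_add, map_sub, map_smul, h1, h2, h3, add_lie, lie_add, smul_lie,
      ls, lie_self, hYX, hXY, h4, h5]
    module

section
variable {A : Type*} [Ring A] [Algebra k A] {Y X : A}
    {D : ℕ → A} (hYX : ⁅Y, X⁆ = X) (hXD : ∀ n, ⁅X, D n⁆ = D (n + 1))
    (hYD : ∀ n, ⁅Y, D n⁆ = ((n : k) + 1) • D n) (hDD : ∀ n m, ⁅D n, D m⁆ = 0)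

@[simp] theorem lieLift_Y : lieLift Y X D hYX hXD hYD hDD (lieY k) = Y := by
  simp [lieLift, lieY]
@[simp] theorem lieLift_X : lieLift Y X D hYX hXD hYD hDD (lieX k) = X := by
  simp [lieLift, lieX]
@[simp] theorem lieLift_δ (n : ℕ) : lieLift Y X D hYX hXD hYD hDD (lieδ k (n + 1)) = D n := by
  simp [lieLift, lieδ]
end

end LieAlgebra

/-! ### The Connes-Moscovici Hopf algebra: the enveloping algebra -/

section HopfAlgebra

open scoped TensorProduct

attribute [local instance] LieRing.ofAssociativeRing

variable (k : Type*) [Field k]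

/-- The Connes-Moscovici Hopf algebra, as an algebra. -/
abbrev HCM : Type _ := UniversalEnvelopingAlgebra k (CMLie k)

/-- The generators `Y`, `X`, `δₙ` (`n ≥ 1`) of `HCM k`. -/
noncomputable def Y : HCM k := UniversalEnvelopingAlgebra.ι k (lieY k)
noncomputable def X : HCM k := UniversalEnvelopingAlgebra.ι k (lieX k)
noncomputable def δ (n : ℕ) : HCM k := UniversalEnvelopingAlgebra.ι k (lieδ k n)

theorem comm_Y_X : Y k * X k - X k * Y k = X k := by
  rw [← LieRing.of_associative_ring_bracket, Y, X, ← LieHom.map_lie, lie_Y_X]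

theorem comm_X_δ (n : ℕ) : X k * δ k (n + 1) - δ k (n + 1) * X k = δ k (n + 2) := by
  rw [← LieRing.of_associative_ring_bracket, δ, X, ← LieHom.map_lie, lie_X_δ, δ]

theorem comm_Y_δ (n : ℕ) : Y k * δ k n - δ k n * Y k = (n : k) • δ k n := by
  rw [← LieRing.of_associative_ring_bracket, δ, Y, ← LieHom.map_lie, lie_Y_δ, map_smul]

theorem comm_δ_δ (n m : ℕ) : δ k n * δ k m = δ k m * δ k n := by
  rw [← sub_eq_zero, ← LieRing.of_associative_ring_bracket, δ, δ, ← LieHom.map_lie, lie_δ_δ,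
    map_zero]

variable {k} in
/-- `X`, `Y`, `δ₁` generate the algebra. -/
theorem algHom_ext {A : Type*} [Ring A] [Algebra k A] {f g : HCM k →ₐ[k] A}
    (hY : f (Y k) = g (Y k)) (hX : f (X k) = g (X k)) (h1 : f (δ k 1) = g (δ k 1)) : f = g := by
  have hδ : ∀ n, f (δ k (n + 1)) = g (δ k (n + 1)) := fun n => by
    induction n with
    | zero => exact h1
    | succ n ih => rw [← comm_X_δ]; simp only [map_sub, map_mul, hX, ih]
  refine UniversalEnvelopingAlgebra.hom_ext k (LieHom.ext fun u => ?_)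
  change f (UniversalEnvelopingAlgebra.ι k u) = g (UniversalEnvelopingAlgebra.ι k u)
  rw [CMLie.eq_sum k u]
  simp only [Finsupp.sum, map_add, map_smul, map_sum]
  simp only [Y, X, δ] at hY hX hδ
  simp only [hY, hX, hδ]

theorem subalgebra_eq_top (S : Subalgebra k (HCM k)) (hY : Y k ∈ S) (hX : X k ∈ S)
    (h1 : δ k 1 ∈ S) : S = ⊤ := by
  have hδ : ∀ n, δ k (n + 1) ∈ S := fun n => by
    induction n with
    | zero => exact h1
    | succ n ih => rw [← comm_X_δ]; exact S.sub_mem (S.mul_mem hX ih) (S.mul_mem ih hX)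
  have hι : ∀ u, UniversalEnvelopingAlgebra.ι k u ∈ S := fun u => by
    rw [CMLie.eq_sum k u]
    simp only [Finsupp.sum, map_add, map_smul, map_sum]
    exact S.add_mem (S.add_mem (S.smul_mem hY _) (S.smul_mem hX _))
      (S.sum_mem fun i _ => S.smul_mem (hδ i) _)
  let f : CMLie k →ₗ⁅k⁆ S :=
    { toFun := fun u => ⟨UniversalEnvelopingAlgebra.ι k u, hι u⟩
      map_add' := fun u v => Subtype.ext (map_add _ u v)
      map_smul' := fun c u => Subtype.ext (map_smul _ c u)
      map_lie' := fun {u v} => Subtype.ext (LieHom.map_lie _ u v) }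
  have h : S.val.comp (UniversalEnvelopingAlgebra.lift k f) = AlgHom.id k _ := by
    refine UniversalEnvelopingAlgebra.hom_ext k (LieHom.ext fun u => ?_)
    change S.val (UniversalEnvelopingAlgebra.lift k f (UniversalEnvelopingAlgebra.ι k u)) = _
    rw [UniversalEnvelopingAlgebra.lift_ι_apply]
    rfl
  refine Algebra.eq_top_iff.2 fun z => ?_
  have := DFunLike.congr_fun h z
  have h2 : ((UniversalEnvelopingAlgebra.lift k f z : S) : HCM k) = z := this
  exact h2 ▸ (UniversalEnvelopingAlgebra.lift k f z).2

/-- The subalgebra `H¹` of `HCM k` generated by `δ₁, δ₂, …`. -/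
noncomputable def H1CM : Subalgebra k (HCM k) := Algebra.adjoin k {z | ∃ n : ℕ, 1 ≤ n ∧ z = δ k n}

variable {k}

theorem δ_mem (n : ℕ) : δ k (n + 1) ∈ H1CM k :=
  Algebra.subset_adjoin ⟨n + 1, Nat.le_add_left 1 n, rfl⟩

theorem H1CM_induction {p : HCM k → Prop} (hδ : ∀ n, p (δ k (n + 1)))
    (halg : ∀ c, p (algebraMap k _ c)) (hadd : ∀ a b, p a → p b → p (a + b))
    (hmul : ∀ a b, a ∈ H1CM k → b ∈ H1CM k → p a → p b → p (a * b)) :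
    ∀ a ∈ H1CM k, p a := fun a ha =>
  Algebra.adjoin_induction (p := fun a _ => p a)
    (fun z hz => by
      obtain ⟨n, hn, rfl⟩ := hz
      obtain ⟨m, rfl⟩ := Nat.exists_eq_add_of_le' hn
      exact hδ m)
    halg (fun a b _ _ => hadd a b) (fun a b ha hb => hmul a b ha hb) ha

theorem H1CM_comm {a b : HCM k} (ha : a ∈ H1CM k) (hb : b ∈ H1CM k) : a * b = b * a := by
  revert a
  change ∀ a ∈ H1CM k, _
  refine H1CM_induction (fun n => ?_) (fun c => Algebra.commutes c b) (fun a a' h h' => ?_)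
    (fun a a' _ _ h h' => ?_)
  · revert b
    change ∀ b ∈ H1CM k, _
    refine H1CM_induction (fun m => comm_δ_δ k _ _) (fun c => (Algebra.commutes c _).symm)
      (fun a a' h h' => ?_) (fun a a' _ _ h h' => ?_)
    · rw [mul_add, add_mul, h, h']
    · rw [← mul_assoc, h, mul_assoc, h', mul_assoc]
  · rw [mul_add, add_mul, h, h']
  · rw [mul_assoc, h', ← mul_assoc, h, mul_assoc]

theorem adX_mem {a : HCM k} (ha : a ∈ H1CM k) : X k * a - a * X k ∈ H1CM k := by
  revert a
  change ∀ a ∈ H1CM k, _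
  refine H1CM_induction (fun n => ?_) (fun c => ?_) (fun a b h h' => ?_)
    (fun a b ha hb h h' => ?_)
  · rw [comm_X_δ]; exact δ_mem _
  · rw [Algebra.commutes, sub_self]; exact zero_mem _
  · convert add_mem h h' using 1; noncomm_ring
  · convert add_mem (mul_mem h hb) (mul_mem ha h') using 1; noncomm_ring

theorem adY_mem {a : HCM k} (ha : a ∈ H1CM k) : Y k * a - a * Y k ∈ H1CM k := by
  revert a
  change ∀ a ∈ H1CM k, _
  refine H1CM_induction (fun n => ?_) (fun c => ?_) (fun a b h h' => ?_)
    (fun a b ha hb h h' => ?_)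
  · rw [comm_Y_δ]; exact Subalgebra.smul_mem _ (δ_mem _) _
  · rw [Algebra.commutes, sub_self]; exact zero_mem _
  · convert add_mem h h' using 1; noncomm_ring
  · convert add_mem (mul_mem h hb) (mul_mem ha h') using 1; noncomm_ring

variable (k)

/-! ### The coproduct -/

/-- `Δ(Y) = Y ⊗ 1 + 1 ⊗ Y`, `Δ(X) = X ⊗ 1 + 1 ⊗ X + δ₁ ⊗ Y`. -/
noncomputable def comulY : HCM k ⊗[k] HCM k := Y k ⊗ₜ 1 + 1 ⊗ₜ Y k
noncomputable def comulX : HCM k ⊗[k] HCM k := X k ⊗ₜ 1 + 1 ⊗ₜ X k + δ k 1 ⊗ₜ Y k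

/-- `Δ(δₙ₊₁)`, from `Δ(δ₁) = δ₁ ⊗ 1 + 1 ⊗ δ₁` and `δₙ₊₁ = [X, δₙ]`. -/
noncomputable def comulδ : ℕ → HCM k ⊗[k] HCM k
  | 0 => δ k 1 ⊗ₜ 1 + 1 ⊗ₜ δ k 1
  | n + 1 => comulX k * comulδ n - comulδ n * comulX k

/-- The inclusion `H¹ ⊗ H¹ → H ⊗ H`. -/
noncomputable def incl₂ : H1CM k ⊗[k] H1CM k →ₐ[k] HCM k ⊗[k] HCM k :=
  Algebra.TensorProduct.map (H1CM k).val (H1CM k).val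

theorem incl₂_comm (z w : H1CM k ⊗[k] H1CM k) : incl₂ k z * incl₂ k w = incl₂ k w * incl₂ k z := by
  induction z with
  | zero => simp
  | add a b ha hb => rw [map_add, add_mul, mul_add, ha, hb]
  | tmul a b =>
    induction w with
    | zero => simp
    | add a b ha hb => rw [map_add, add_mul, mul_add, ha, hb]
    | tmul c d =>
      simp only [incl₂, Algebra.TensorProduct.map_tmul, Subalgebra.coe_val,
        Algebra.TensorProduct.tmul_mul_tmul]
      rw [H1CM_comm a.2 c.2, H1CM_comm b.2 d.2]

theorem comulX_incl₂ (z : H1CM k ⊗[k] H1CM k) :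
    comulX k * incl₂ k z - incl₂ k z * comulX k ∈ (incl₂ k).range := by
  induction z with
  | zero => simp
  | add a b ha hb =>
    convert add_mem ha hb using 1; rw [map_add]; noncomm_ring
  | tmul a b =>
    refine ⟨(⟨_, adX_mem a.2⟩ : H1CM k) ⊗ₜ b + a ⊗ₜ (⟨_, adX_mem b.2⟩ : H1CM k) +
      (⟨δ k 1, δ_mem 0⟩ * a) ⊗ₜ (⟨_, adY_mem b.2⟩ : H1CM k), ?_⟩
    have h := H1CM_comm (δ_mem 0) a.2
    rw [zero_add] at h
    simp only [incl₂, comulX, RingHom.coe_coe, map_add, AlgHom.toRingHom_eq_coe,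
      Algebra.TensorProduct.map_tmul, Subalgebra.coe_val, MulMemClass.coe_mul, add_mul, mul_add,
      Algebra.TensorProduct.tmul_mul_tmul, one_mul, mul_one, TensorProduct.sub_tmul,
      TensorProduct.tmul_sub, ← h]
    abel

theorem comulδ_mem (n : ℕ) : comulδ k n ∈ (incl₂ k).range := by
  induction n with
  | zero =>
    refine ⟨(⟨δ k 1, δ_mem 0⟩ : H1CM k) ⊗ₜ 1 + 1 ⊗ₜ (⟨δ k 1, δ_mem 0⟩ : H1CM k), ?_⟩
    simp [incl₂, comulδ]
  | succ n ih =>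
    obtain ⟨z, hz⟩ := ih
    rw [comulδ, ← hz]
    exact comulX_incl₂ k z

theorem comulYX : comulY k * comulX k - comulX k * comulY k = comulX k := by
  have h1 := comm_Y_X k
  have h2 := comm_Y_δ k 1
  rw [sub_eq_iff_eq_add] at h1 h2
  simp only [comulX, comulY, add_mul, mul_add, Algebra.TensorProduct.tmul_mul_tmul, one_mul,
    mul_one, h1, h2, TensorProduct.add_tmul, TensorProduct.tmul_add, Nat.cast_one, one_smul]
  abel

theorem comulYδ (n : ℕ) :
    comulY k * comulδ k n - comulδ k n * comulY k = ((n : k) + 1) • comulδ k n := by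
  induction n with
  | zero =>
    have h2 := comm_Y_δ k 1
    rw [sub_eq_iff_eq_add] at h2
    simp only [comulδ, comulY, add_mul, mul_add, Algebra.TensorProduct.tmul_mul_tmul, one_mul,
      mul_one, h2, TensorProduct.add_tmul, TensorProduct.tmul_add, Nat.cast_one, one_smul,
      Nat.cast_zero, zero_add]
    abel
  | succ n ih =>
    have h := comulYX k
    simp only [comulδ]
    generalize comulδ k n = d at *
    generalize comulX k = x at *
    generalize comulY k = y at *
    have : y * (x * d - d * x) - (x * d - d * x) * y =
      (y * x - x * y) * d - d * (y * x - x * y) + (x * (y * d - d * y) - (y * d - d * y) * x) := by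
      noncomm_ring
    rw [this, h, ih, mul_smul_comm, smul_mul_assoc]
    push_cast
    module

/-- The coproduct of `HCM k`, an algebra homomorphism. -/
noncomputable def comulHom : HCM k →ₐ[k] HCM k ⊗[k] HCM k :=
  UniversalEnvelopingAlgebra.lift k <| lieLift (comulY k) (comulX k) (comulδ k)
    (comulYX k) (fun n => by rw [LieRing.of_associative_ring_bracket, comulδ]) (comulYδ k)
    fun n m => by
      obtain ⟨z, hz⟩ := comulδ_mem k n
      obtain ⟨w, hw⟩ := comulδ_mem k m
      rw [LieRing.of_associative_ring_bracket, ← hz, ← hw, sub_eq_zero]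
      exact incl₂_comm k z w

@[simp] theorem comulHom_Y : comulHom k (Y k) = Y k ⊗ₜ 1 + 1 ⊗ₜ Y k := by
  rw [comulHom, Y, UniversalEnvelopingAlgebra.lift_ι_apply, lieLift_Y]; rfl
@[simp] theorem comulHom_X : comulHom k (X k) = X k ⊗ₜ 1 + 1 ⊗ₜ X k + δ k 1 ⊗ₜ Y k := by
  rw [comulHom, X, UniversalEnvelopingAlgebra.lift_ι_apply, lieLift_X]; rfl
theorem comulHom_δ (n : ℕ) : comulHom k (δ k (n + 1)) = comulδ k n := by
  rw [comulHom, δ, UniversalEnvelopingAlgebra.lift_ι_apply, lieLift_δ]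
@[simp] theorem comulHom_δ_one : comulHom k (δ k 1) = δ k 1 ⊗ₜ 1 + 1 ⊗ₜ δ k 1 :=
  comulHom_δ k 0

/-- The counit of `HCM k`, which vanishes on the Lie algebra. -/
noncomputable def counitHom : HCM k →ₐ[k] k := UniversalEnvelopingAlgebra.lift k 0

@[simp] theorem counitHom_Y : counitHom k (Y k) = 0 := by
  rw [counitHom, Y, UniversalEnvelopingAlgebra.lift_ι_apply]; rfl
@[simp] theorem counitHom_X : counitHom k (X k) = 0 := by
  rw [counitHom, X, UniversalEnvelopingAlgebra.lift_ι_apply]; rfl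
@[simp] theorem counitHom_δ (n : ℕ) : counitHom k (δ k n) = 0 := by
  rw [counitHom, δ, UniversalEnvelopingAlgebra.lift_ι_apply]; rfl

noncomputable instance : Bialgebra k (HCM k) :=
  Bialgebra.ofAlgHom (comulHom k) (counitHom k)
    (by
      apply algHom_ext <;>
      simp [TensorProduct.add_tmul, TensorProduct.tmul_add, Algebra.TensorProduct.one_def] <;> abel)
    (by apply algHom_ext <;> simp)
    (by apply algHom_ext <;> simp)

/-! ### The antipode -/

/-- `S(X) = -X + δ₁ Y`. -/
noncomputable def antX : HCM k := -X k + δ k 1 * Y k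

/-- `S(δₙ₊₁)`, from `S(δ₁) = -δ₁` and the antimultiplicativity of `S`. -/
noncomputable def antδ : ℕ → HCM k
  | 0 => -δ k 1
  | n + 1 => antδ n * antX k - antX k * antδ n

theorem antδ_mem (n : ℕ) : antδ k n ∈ H1CM k := by
  induction n with
  | zero => exact neg_mem (δ_mem 0)
  | succ n ih =>
    have h := H1CM_comm (δ_mem 0) ih
    rw [zero_add] at h
    convert sub_mem (adX_mem ih) (mul_mem (δ_mem 0) (adY_mem ih)) using 1
    rw [antδ, antX, zero_add, mul_add, ← mul_assoc, ← h]
    noncomm_ring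

theorem antYX : antX k * -Y k - -Y k * antX k = antX k := by
  have h1 := comm_Y_X k
  have h2 := comm_Y_δ k 1
  rw [sub_eq_iff_eq_add] at h1 h2
  rw [Nat.cast_one, one_smul] at h2
  rw [antX]
  simp only [mul_add, add_mul, mul_neg, neg_mul, ← mul_assoc, h1, h2]
  abel

theorem antYδ (n : ℕ) :
    antδ k n * -Y k - -Y k * antδ k n = ((n : k) + 1) • antδ k n := by
  induction n with
  | zero =>
    have h2 := comm_Y_δ k 1
    rw [sub_eq_iff_eq_add, Nat.cast_one, one_smul] at h2
    simp only [antδ, mul_neg, neg_mul, h2, Nat.cast_zero, zero_add, one_smul]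
    abel
  | succ n ih =>
    have h := antYX k
    simp only [antδ]
    generalize antδ k n = d at *
    generalize antX k = x at *
    generalize -Y k = y at *
    have : (d * x - x * d) * y - y * (d * x - x * d) =
      d * (x * y - y * x) - (x * y - y * x) * d + ((d * y - y * d) * x - x * (d * y - y * d)) := by
      noncomm_ring
    rw [this, h, ih, mul_smul_comm, smul_mul_assoc]
    push_cast
    module

open MulOpposite in
/-- The antipode of `HCM k` as an algebra homomorphism to the opposite algebra. -/
noncomputable def antipodeHom : HCM k →ₐ[k] (HCM k)ᵐᵒᵖ :=
  UniversalEnvelopingAlgebra.lift k <| lieLift (op (-Y k)) (op (antX k)) (fun n => op (antδ k n))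
    (by
      rw [LieRing.of_associative_ring_bracket, ← op_mul, ← op_mul, ← op_sub, antYX])
    (fun n => by
      rw [LieRing.of_associative_ring_bracket, ← op_mul, ← op_mul, ← op_sub, antδ])
    (fun n => by
      rw [LieRing.of_associative_ring_bracket, ← op_mul, ← op_mul, ← op_sub, antYδ, op_smul])
    fun n m => by
      rw [LieRing.of_associative_ring_bracket, ← op_mul, ← op_mul, ← op_sub,
        H1CM_comm (antδ_mem k n) (antδ_mem k m), sub_self, op_zero]

/-- The antipode of `HCM k`. -/
noncomputable def antipodeMap : HCM k →ₗ[k] HCM k :=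
  (MulOpposite.opLinearEquiv k).symm.toLinearMap ∘ₗ (antipodeHom k).toLinearMap

theorem antipodeMap_one : antipodeMap k 1 = 1 := by simp [antipodeMap]
theorem antipodeMap_mul (a b : HCM k) :
    antipodeMap k (a * b) = antipodeMap k b * antipodeMap k a := by simp [antipodeMap]
theorem antipodeMap_Y : antipodeMap k (Y k) = -Y k := by
  change MulOpposite.unop (antipodeHom k (UniversalEnvelopingAlgebra.ι k (lieY k))) = _
  rw [antipodeHom, UniversalEnvelopingAlgebra.lift_ι_apply, lieLift_Y]; rfl
theorem antipodeMap_X : antipodeMap k (X k) = -X k + δ k 1 * Y k := by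
  change MulOpposite.unop (antipodeHom k (X k)) = _
  rw [antipodeHom, X, UniversalEnvelopingAlgebra.lift_ι_apply, lieLift_X]; rfl
theorem antipodeMap_δ (n : ℕ) : antipodeMap k (δ k (n + 1)) = antδ k n := by
  change MulOpposite.unop (antipodeHom k (δ k (n + 1))) = _
  rw [antipodeHom, δ, UniversalEnvelopingAlgebra.lift_ι_apply, lieLift_δ]; rfl
theorem antipodeMap_δ_one : antipodeMap k (δ k 1) = -δ k 1 := antipodeMap_δ k 0

theorem antipodeMap_mem {a : HCM k} (ha : a ∈ H1CM k) : antipodeMap k a ∈ H1CM k := by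
  revert a
  change ∀ a ∈ H1CM k, _
  refine H1CM_induction (fun n => ?_) (fun c => ?_) (fun a b h h' => ?_)
    (fun a b _ _ h h' => ?_)
  · rw [antipodeMap_δ]; exact antδ_mem k n
  · rw [Algebra.algebraMap_eq_smul_one, map_smul, antipodeMap_one]
    exact Subalgebra.smul_mem _ (one_mem _) _
  · rw [map_add]; exact add_mem h h'
  · rw [antipodeMap_mul]; exact mul_mem h' h

/-- `a ⊗ b ↦ S(a) b` and `a ⊗ b ↦ a S(b)`. -/
noncomputable def convL : HCM k ⊗[k] HCM k →ₗ[k] HCM k :=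
  LinearMap.mul' k _ ∘ₗ (antipodeMap k).rTensor _
noncomputable def convR : HCM k ⊗[k] HCM k →ₗ[k] HCM k :=
  LinearMap.mul' k _ ∘ₗ (antipodeMap k).lTensor _

variable {k} in
theorem convL_mul {c : k} {z : HCM k ⊗[k] HCM k} (hz : convL k z = algebraMap k _ c)
    (w : HCM k ⊗[k] HCM k) : convL k (z * w) = c • convL k w := by
  induction w with
  | zero => simp
  | add a b ha hb => rw [mul_add, map_add, ha, hb, map_add, smul_add]
  | tmul a b =>
    have : convL k (z * a ⊗ₜ b) = antipodeMap k a * convL k z * b := by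
      clear hz
      induction z with
      | zero => simp
      | add x y hx hy => rw [add_mul, map_add, hx, hy, map_add, mul_add, add_mul]
      | tmul x y => simp [convL, antipodeMap_mul, mul_assoc]
    rw [this, hz, ← Algebra.commutes, mul_assoc, Algebra.smul_def]
    simp [convL]

variable {k} in
theorem convR_mul {c : k} {w : HCM k ⊗[k] HCM k} (hw : convR k w = algebraMap k _ c)
    (z : HCM k ⊗[k] HCM k) : convR k (z * w) = c • convR k z := by
  induction z with
  | zero => simp
  | add a b ha hb => rw [add_mul, map_add, ha, hb, map_add, smul_add]
  | tmul a b =>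
    have : convR k (a ⊗ₜ b * w) = a * convR k w * antipodeMap k b := by
      clear hw
      induction w with
      | zero => simp
      | add x y hx hy => rw [mul_add, map_add, hx, hy, map_add, mul_add, add_mul]
      | tmul x y => simp [convR, antipodeMap_mul, mul_assoc]
    rw [this, hw, ← Algebra.commutes, mul_assoc, Algebra.smul_def]
    simp [convR]

theorem convL_comul (a : HCM k) : convL k (comulHom k a) = algebraMap k _ (counitHom k a) := by
  let S : Subalgebra k (HCM k) :=
    { carrier := {a | convL k (comulHom k a) = algebraMap k _ (counitHom k a)}
      mul_mem' := fun {a b} (ha : _ = _) (hb : _ = _) => by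
        change _ = _
        rw [map_mul, convL_mul ha, hb, map_mul, map_mul, Algebra.smul_def]
      add_mem' := fun {a b} (ha : _ = _) (hb : _ = _) => by
        change _ = _
        simp only [map_add, ha, hb]
      algebraMap_mem' := fun c => by
        change _ = _
        rw [AlgHom.commutes, AlgHom.commutes, Algebra.algebraMap_eq_smul_one, map_smul,
          Algebra.TensorProduct.one_def]
        simp [convL, antipodeMap_one, Algebra.algebraMap_eq_smul_one] }
  have : S = ⊤ := by
    refine subalgebra_eq_top k S ?_ ?_ ?_
    · change _ = _
      simp [convL, antipodeMap_Y, antipodeMap_one]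
    · change _ = _
      simp [convL, antipodeMap_X, antipodeMap_δ_one, antipodeMap_one]
    · change _ = _
      simp [convL, antipodeMap_δ_one, antipodeMap_one]
  exact (this ▸ Algebra.mem_top : a ∈ S)

theorem convR_comul (a : HCM k) : convR k (comulHom k a) = algebraMap k _ (counitHom k a) := by
  let S : Subalgebra k (HCM k) :=
    { carrier := {a | convR k (comulHom k a) = algebraMap k _ (counitHom k a)}
      mul_mem' := fun {a b} (ha : _ = _) (hb : _ = _) => by
        change _ = _
        rw [map_mul, convR_mul hb, ha, map_mul, map_mul, Algebra.smul_def, ← map_mul, mul_comm,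
          map_mul]
      add_mem' := fun {a b} (ha : _ = _) (hb : _ = _) => by
        change _ = _
        simp only [map_add, ha, hb]
      algebraMap_mem' := fun c => by
        change _ = _
        rw [AlgHom.commutes, AlgHom.commutes, Algebra.algebraMap_eq_smul_one, map_smul,
          Algebra.TensorProduct.one_def]
        simp [convR, antipodeMap_one, Algebra.algebraMap_eq_smul_one] }
  have : S = ⊤ := by
    refine subalgebra_eq_top k S ?_ ?_ ?_
    · change _ = _
      simp [convR, antipodeMap_Y, antipodeMap_one]
    · change _ = _
      simp [convR, antipodeMap_X, antipodeMap_Y, antipodeMap_one]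
    · change _ = _
      simp [convR, antipodeMap_δ_one, antipodeMap_one]
  exact (this ▸ Algebra.mem_top : a ∈ S)

/-- The Connes-Moscovici Hopf algebra. -/
noncomputable instance : HopfAlgebra k (HCM k) where
  antipode := antipodeMap k
  mul_antipode_rTensor_comul := LinearMap.ext (convL_comul k)
  mul_antipode_lTensor_comul := LinearMap.ext (convR_comul k)

/-! ### The Hopf subalgebra `H¹` -/

theorem incl₂_injective : Function.Injective (incl₂ k) :=
  TensorProduct.map_injective_of_flat_flat (H1CM k).val.toLinearMap (H1CM k).val.toLinearMap
    Subtype.val_injective Subtype.val_injective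

theorem comulHom_mem (a : H1CM k) : comulHom k a ∈ (incl₂ k).range := by
  obtain ⟨a, ha⟩ := a
  revert a
  change ∀ a ∈ H1CM k, comulHom k a ∈ (incl₂ k).range
  refine H1CM_induction (fun n => ?_) (fun c => ?_) (fun a b h h' => ?_)
    (fun a b _ _ h h' => ?_)
  · rw [comulHom_δ]; exact comulδ_mem k n
  · rw [AlgHom.commutes]; exact Subalgebra.algebraMap_mem _ c
  · rw [map_add]; exact add_mem h h'
  · rw [map_mul]; exact mul_mem h h'

/-- The coproduct of `H¹`, the restriction of the one of `HCM k`. -/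
noncomputable def comulHom₁ : H1CM k →ₐ[k] H1CM k ⊗[k] H1CM k :=
  (AlgEquiv.ofInjective (incl₂ k) (incl₂_injective k)).symm.toAlgHom.comp
    (((comulHom k).comp (H1CM k).val).codRestrict (incl₂ k).range (comulHom_mem k))

/-- The inclusion of `H¹` in `HCM k` commutes with the coproducts. -/
theorem incl₂_comulHom₁ (a : H1CM k) : incl₂ k (comulHom₁ k a) = comulHom k a := by
  have := AlgEquiv.apply_symm_apply (AlgEquiv.ofInjective (incl₂ k) (incl₂_injective k))
    (((comulHom k).comp (H1CM k).val).codRestrict (incl₂ k).range (comulHom_mem k) a)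
  exact congrArg Subtype.val this

@[simp] theorem incl₂_tmul (a b : H1CM k) : incl₂ k (a ⊗ₜ b) = (a : HCM k) ⊗ₜ (b : HCM k) := rfl

/-- The inclusion `H¹ ⊗ (H¹ ⊗ H¹) → H ⊗ (H ⊗ H)`. -/
noncomputable def incl₃ :
    H1CM k ⊗[k] (H1CM k ⊗[k] H1CM k) →ₐ[k] HCM k ⊗[k] (HCM k ⊗[k] HCM k) :=
  Algebra.TensorProduct.map (H1CM k).val (incl₂ k)

theorem incl₃_injective : Function.Injective (incl₃ k) :=
  TensorProduct.map_injective_of_flat_flat (H1CM k).val.toLinearMap (incl₂ k).toLinearMap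
    Subtype.val_injective (incl₂_injective k)

set_option synthInstance.maxHeartbeats 200000 in
theorem coassoc₁ (a : H1CM k) :
    TensorProduct.assoc k _ _ _ ((comulHom₁ k).toLinearMap.rTensor _ (comulHom₁ k a)) =
      (comulHom₁ k).toLinearMap.lTensor _ (comulHom₁ k a) := by
  apply incl₃_injective k
  have h1 : ∀ z : H1CM k ⊗[k] H1CM k,
      incl₃ k (TensorProduct.assoc k _ _ _ ((comulHom₁ k).toLinearMap.rTensor _ z)) =
      TensorProduct.assoc k _ _ _ ((comulHom k).toLinearMap.rTensor _ (incl₂ k z)) := fun z => by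
    induction z with
    | zero => simp
    | add x y hx hy => simp only [map_add, hx, hy]
    | tmul x y =>
      have h : ∀ w : H1CM k ⊗[k] H1CM k,
          incl₃ k (TensorProduct.assoc k _ _ _ (w ⊗ₜ y)) =
          TensorProduct.assoc k _ _ _ (incl₂ k w ⊗ₜ (y : HCM k)) := fun w => by
        induction w with
        | zero => simp
        | add u v hu hv => simp only [map_add, TensorProduct.add_tmul, hu, hv]
        | tmul u v => rfl
      have := h (comulHom₁ k x)
      rw [incl₂_comulHom₁] at this
      exact this
  have h2 : ∀ z : H1CM k ⊗[k] H1CM k,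
      incl₃ k ((comulHom₁ k).toLinearMap.lTensor _ z) =
      (comulHom k).toLinearMap.lTensor _ (incl₂ k z) := fun z => by
    induction z with
    | zero => simp
    | add x y hx hy => simp only [map_add, hx, hy]
    | tmul x y =>
      change (x : HCM k) ⊗ₜ[k] incl₂ k (comulHom₁ k y) = (x : HCM k) ⊗ₜ[k] comulHom k y
      rw [incl₂_comulHom₁]
  rw [h1, h2, incl₂_comulHom₁]
  exact Coalgebra.coassoc_apply (R := k) (a : HCM k)

/-- The coalgebra structure of `H¹`, restricted from `HCM k`. -/
noncomputable instance : Coalgebra k (H1CM k) where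
  comul := (comulHom₁ k).toLinearMap
  counit := ((counitHom k).comp (H1CM k).val).toLinearMap
  coassoc := LinearMap.ext (coassoc₁ k)
  rTensor_counit_comp_comul := LinearMap.ext fun a => by
    have inj : Function.Injective ((H1CM k).val.toLinearMap.lTensor k) :=
      Module.Flat.lTensor_preserves_injective_linearMap _ Subtype.val_injective
    apply inj
    have h : ∀ z : H1CM k ⊗[k] H1CM k, (H1CM k).val.toLinearMap.lTensor k
        (((counitHom k).comp (H1CM k).val).toLinearMap.rTensor _ z) =
        (counitHom k).toLinearMap.rTensor _ (incl₂ k z) := fun z => by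
      induction z with
      | zero => simp
      | add x y hx hy => simp only [map_add, hx, hy]
      | tmul x y => rfl
    refine (h (comulHom₁ k a)).trans ?_
    rw [incl₂_comulHom₁]
    exact Coalgebra.rTensor_counit_comul (R := k) (a : HCM k)
  lTensor_counit_comp_comul := LinearMap.ext fun a => by
    have inj : Function.Injective ((H1CM k).val.toLinearMap.rTensor k) :=
      Module.Flat.rTensor_preserves_injective_linearMap _ Subtype.val_injective
    apply inj
    have h : ∀ z : H1CM k ⊗[k] H1CM k, (H1CM k).val.toLinearMap.rTensor k
        (((counitHom k).comp (H1CM k).val).toLinearMap.lTensor _ z) =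
        (counitHom k).toLinearMap.lTensor _ (incl₂ k z) := fun z => by
      induction z with
      | zero => simp
      | add x y hx hy => simp only [map_add, hx, hy]
      | tmul x y => rfl
    refine (h (comulHom₁ k a)).trans ?_
    rw [incl₂_comulHom₁]
    exact Coalgebra.lTensor_counit_comul (R := k) (a : HCM k)

noncomputable instance : Bialgebra k (H1CM k) :=
  Bialgebra.mk' k (H1CM k) (map_one ((counitHom k).comp (H1CM k).val))
    (fun {a b} => map_mul ((counitHom k).comp (H1CM k).val) a b) (map_one (comulHom₁ k))
    (fun {a b} => map_mul (comulHom₁ k) a b)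

/-- The antipode of `H¹`, the restriction of the one of `HCM k`. -/
noncomputable def antipodeMap₁ : H1CM k →ₗ[k] H1CM k :=
  (antipodeMap k).restrict (p := (H1CM k).toSubmodule) (q := (H1CM k).toSubmodule)
    fun _ h => antipodeMap_mem k h

/-- The Hopf algebra `H¹`, with the structure restricted from `HCM k`. -/
noncomputable instance : HopfAlgebra k (H1CM k) where
  antipode := antipodeMap₁ k
  mul_antipode_rTensor_comul := LinearMap.ext fun a => by
    apply Subtype.val_injective
    have h : ∀ z : H1CM k ⊗[k] H1CM k,
        ((LinearMap.mul' k _ ((antipodeMap₁ k).rTensor _ z) : H1CM k) : HCM k) =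
        convL k (incl₂ k z) := fun z => by
      induction z with
      | zero => simp
      | add x y hx hy => simp only [map_add, hx, hy, Subalgebra.coe_add]
      | tmul x y => rfl
    refine (h (comulHom₁ k a)).trans ?_
    rw [incl₂_comulHom₁]
    exact convL_comul k a
  mul_antipode_lTensor_comul := LinearMap.ext fun a => by
    apply Subtype.val_injective
    have h : ∀ z : H1CM k ⊗[k] H1CM k,
        ((LinearMap.mul' k _ ((antipodeMap₁ k).lTensor _ z) : H1CM k) : HCM k) =
        convR k (incl₂ k z) := fun z => by
      induction z with
      | zero => simp
      | add x y hx hy => simp only [map_add, hx, hy, Subalgebra.coe_add]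
      | tmul x y => rfl
    refine (h (comulHom₁ k a)).trans ?_
    rw [incl₂_comulHom₁]
    exact convR_comul k a

/-- The inclusion `H¹ → HCM k` respects the Hopf algebra structures. -/
theorem coe_comul (a : H1CM k) :
    TensorProduct.map (H1CM k).val.toLinearMap (H1CM k).val.toLinearMap
      (Coalgebra.comul (R := k) a) = Coalgebra.comul (R := k) (a : HCM k) :=
  incl₂_comulHom₁ k a
theorem coe_counit (a : H1CM k) :
    Coalgebra.counit (R := k) a = Coalgebra.counit (R := k) (a : HCM k) := rfl
theorem coe_antipode (a : H1CM k) :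
    (HopfAlgebra.antipode k a : HCM k) = HopfAlgebra.antipode k (a : HCM k) := rfl

/-- The coproduct of `HCM k` on the generators. -/
theorem comul_Y : Coalgebra.comul (R := k) (Y k) = Y k ⊗ₜ[k] 1 + 1 ⊗ₜ[k] Y k := comulHom_Y k
theorem comul_X : Coalgebra.comul (R := k) (X k) =
    X k ⊗ₜ[k] 1 + 1 ⊗ₜ[k] X k + δ k 1 ⊗ₜ[k] Y k := comulHom_X k
theorem comul_δ_one : Coalgebra.comul (R := k) (δ k 1) = δ k 1 ⊗ₜ[k] 1 + 1 ⊗ₜ[k] δ k 1 :=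
  comulHom_δ_one k

/-- The generator `δₙ` (`n ≥ 1`) as an element of `H¹` (the value at `n = 0` is `0`). -/
noncomputable def δH1 (n : ℕ) : H1CM k :=
  ⟨δ k n, by
    rcases n with _ | n
    · simp [δ, lieδ]
    · exact δ_mem n⟩

end HopfAlgebra

/-! ### Compositions and their splittings -/

/-- `split n` is the finite set of all splittings of the tuple `n`, that is, of all tuples
`(n¹, …, nᵗ)` of nonempty tuples whose concatenation is `n`. -/
def split (n : List ℕ) : Finset (List (List ℕ)) :=
  Finset.univ.image fun c : Composition n.length => n.splitWrtComposition c

theorem mem_split {n : List ℕ} {p : List (List ℕ)} :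
    p ∈ split n ↔ p.flatten = n ∧ ∀ m ∈ p, m ≠ [] := by
  constructor
  · intro h
    obtain ⟨c, -, rfl⟩ := Finset.mem_image.1 h
    refine ⟨List.flatten_splitWrtComposition _ _, fun m hm => ?_⟩
    exact List.length_pos_iff.1 (List.length_pos_of_mem_splitWrtComposition hm)
  · rintro ⟨rfl, h⟩
    refine Finset.mem_image.2 ⟨⟨p.map List.length, ?_, ?_⟩, Finset.mem_univ _, ?_⟩
    · intro i hi
      obtain ⟨m, hm, rfl⟩ := List.mem_map.1 hi
      exact List.length_pos_iff.2 (h m hm)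
    · rw [List.length_flatten]
    · exact List.splitWrtComposition_flatten _ _ rfl

/-- `A(n¹, …, nᵗ) = 1 / (l(n¹)! ⋯ l(nᵗ)!) · ∏ᵢ 1 / (‖nⁱ‖ + 1)`, where `l` is the length and
`‖·‖` the sum of the entries of a tuple. -/
def coeffA (p : List (List ℕ)) : ℚ :=
  1 / (p.map fun m => (m.length.factorial : ℚ)).prod *
    (p.map fun m => 1 / ((m.sum : ℚ) + 1)).prod

/-- `B_k(n¹, …, nᵗ) = ∏ᵢ C(‖nⁱ⁺¹‖ + ⋯ + ‖nᵗ‖ + k, l(nⁱ))`, where the factor for `i = t` is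
`C(k, l(nᵗ))`. -/
def coeffB (k : ℕ) : List (List ℕ) → ℕ
  | [] => 1
  | m :: p => ((p.map List.sum).sum + k).choose m.length * coeffB k p

/-- `U^m_k = ∑_{i = 1}^{l(m)} (-1)^{i-1} ∑_{m¹ ⋯ mⁱ = m} B_k(m¹, …, mⁱ)`. -/
def coeffU (m : List ℕ) (k : ℕ) : ℚ :=
  ∑ i ∈ Finset.Icc 1 m.length, (-1) ^ (i - 1) *
    ∑ p ∈ split m with p.length = i, (coeffB k p : ℚ)

/-- `β^{n₁} = -1`, and for `s ≥ 1`
`β^{n₁, …, nₛ, nₛ₊₁} = ∑_{t = 1}^s ∑_{n¹ ⋯ nᵗ = (n₁, …, nₛ)} U^{‖n¹‖, …, ‖nᵗ‖}_{nₛ₊₁} A(n¹, …, nᵗ)`.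
(The value at the empty tuple plays no role.) -/
def coeffBeta (n : List ℕ) : ℚ :=
  if n.length ≤ 1 then -1
  else ∑ t ∈ Finset.Icc 1 (n.length - 1),
    ∑ p ∈ split n.dropLast with p.length = t,
      coeffU (p.map List.sum) (n.getLastD 0) * coeffA p

end ConnesMoscovici

namespace ConnesMoscovici

/-! ### Sums over compositions, as lists of positive integers -/

section Combinatorics

open Finset

/-! Let `D = [X, ·]` on `H¹` and `sₙ = S(δₙ)`. Since `S` reverses products and `S(X) = -X + δ₁ Y`,
applying it to `δₙ₊₂ = [X, δₙ₊₁]` gives `sₙ₊₂ = D sₙ₊₁ - (n + 1) δ₁ sₙ₊₁` (`antipode_δH1_add_two`).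
This is a recursion in a commutative `ℚ`-algebra with a derivation, and `recursion_solution` solves
it.

Put `f = ∑ δₙ tⁿ / n!` and let `φ` be the integral of `exp f` without constant term. Thus `δₙ` is
the `n`-th Taylor coefficient of `log φ'`, and the antipode should correspond to the compositional
inverse: `∑ sₙ φⁿ / n! = -f`, the logarithm of the chain rule. The formal proof is a differential
equation. From `D f = f' - δ₁` follows `φ' = 1 + δ₁ φ + D φ` (`expSeries_eq`). Then both sides of
the identity solve `D h - h' = δ₁` with constant term `0`, which has one solution
(`sum_mul_coeff_pow`).

With `φ = t (1 + g)`, comparing coefficients gives a unitriangular linear system for the `sₙ / n!`.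
Its entries, coefficients of `(1 + g)ⁿ`, are sums over compositions weighted by binomials. Its
inverse is an alternating sum over splittings of compositions, which is where `B` and `U` come from
(`sum_choose_mul_coeffV`, `sum_coeffV_mul_coeff_pow`). The coefficients of `g` are polynomials in
the `δᵢ / i!`, obtained by expanding `exp f`; substituting them produces `A`
(`sum_comps_smul_prod`). The right-hand side `-f` supplies the last entry of the tuple in `β`. -/

/-- The lists of positive integers with sum `n`. -/
def comps (n : ℕ) : Finset (List ℕ) := univ.image (Composition.blocks (n := n))

theorem mem_comps {n : ℕ} {l : List ℕ} : l ∈ comps n ↔ l.sum = n ∧ ∀ i ∈ l, 0 < i := by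
  constructor
  · intro h
    obtain ⟨c, -, rfl⟩ := mem_image.1 h
    exact ⟨c.blocks_sum, fun i hi => c.blocks_pos hi⟩
  · rintro ⟨h, h'⟩
    exact mem_image.2 ⟨⟨l, fun {i} hi => h' i hi, h⟩, mem_univ _, rfl⟩

theorem sum_composition {M : Type*} [AddCommMonoid M] (n : ℕ) (F : List ℕ → M) :
    ∑ c : Composition n, F c.blocks = ∑ l ∈ comps n, F l := by
  rw [comps, sum_image]
  exact fun c _ c' _ h => Composition.ext h

theorem comps_zero : comps 0 = {[]} := by
  ext l
  rw [mem_comps, mem_singleton]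
  constructor
  · rintro ⟨h, h'⟩
    rcases l with _ | ⟨a, l⟩
    · rfl
    · have := h' a (by simp)
      simp at h
      omega
  · rintro rfl
    simp

theorem ne_nil_of_mem_comps {n : ℕ} (hn : n ≠ 0) {l : List ℕ} (h : l ∈ comps n) : l ≠ [] := by
  rintro rfl
  exact hn (mem_comps.1 h).1.symm

/-- The ways to write a list as a concatenation of two lists. -/
def cuts (l : List ℕ) : Finset (List ℕ × List ℕ) :=
  (range (l.length + 1)).image fun i => (l.take i, l.drop i)

theorem mem_cuts {l : List ℕ} {c : List ℕ × List ℕ} : c ∈ cuts l ↔ c.1 ++ c.2 = l := by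
  constructor
  · intro h
    obtain ⟨i, -, rfl⟩ := mem_image.1 h
    exact List.take_append_drop i l
  · rintro rfl
    exact mem_image.2 ⟨c.1.length, by simp, by simp⟩

theorem cuts_nil : cuts [] = {([], [])} := by
  ext ⟨a, b⟩
  simp [mem_cuts]

variable {M : Type*} [AddCommMonoid M]

theorem sum_ite_zero_left {ι : Type*} (s : Finset ι) (P : ι → Prop) [DecidablePred P] (g : ι → M) :
    ∑ i ∈ s, (if P i then 0 else g i) = ∑ i ∈ s with ¬ P i, g i := by
  simp only [sum_filter, ite_not]

/-- Combinatorial form of the Cauchy product: concatenation is undone by the cut, and the two sums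
are recovered from the pieces. -/
theorem sum_comps_cuts (J : ℕ) (F : List ℕ → List ℕ → M) :
    ∑ n ∈ comps J, ∑ c ∈ cuts n, F c.1 c.2 =
      ∑ x ∈ antidiagonal J, ∑ q ∈ comps x.1, ∑ r ∈ comps x.2, F q r := by
  simp only [← sum_product']
  rw [sum_sigma', sum_sigma']
  refine sum_nbij' (fun z => ⟨(z.2.1.sum, z.2.2.sum), z.2⟩) (fun z => ⟨z.2.1 ++ z.2.2, z.2⟩)
    ?_ ?_ ?_ ?_ ?_
  · rintro ⟨n, q, r⟩ h
    simp only [mem_sigma, mem_cuts, mem_comps, mem_product,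
      HasAntidiagonal.mem_antidiagonal] at h ⊢
    obtain ⟨⟨rfl, h⟩, rfl⟩ := h
    simp only [List.mem_append] at h
    exact ⟨List.sum_append.symm, ⟨trivial, fun i hi => h i (.inl hi)⟩, trivial, fun i hi => h i (.inr hi)⟩
  · rintro ⟨⟨i, j⟩, q, r⟩ h
    simp only [mem_sigma, mem_cuts, mem_comps, mem_product,
      HasAntidiagonal.mem_antidiagonal] at h ⊢
    obtain ⟨rfl, ⟨rfl, h⟩, rfl, h'⟩ := h
    refine ⟨⟨List.sum_append, fun i hi => ?_⟩, trivial⟩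
    exact (List.mem_append.1 hi).elim (h i) (h' i)
  · rintro ⟨n, q, r⟩ h
    simp only [mem_sigma, mem_cuts] at h
    obtain ⟨-, rfl⟩ := h
    rfl
  · rintro ⟨⟨i, j⟩, q, r⟩ h
    simp only [mem_sigma, mem_comps, mem_product] at h
    obtain ⟨-, ⟨rfl, -⟩, rfl, -⟩ := h
    rfl
  · intros; rfl

/-- The zero value at `x.1 = 0` lets the first entry range over a full antidiagonal, so that the sum
can be matched term by term with a product of power series. -/
theorem sum_comps_cons {J : ℕ} (hJ : J ≠ 0) (F : List ℕ → M) :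
    ∑ n ∈ comps J, F n =
      ∑ x ∈ antidiagonal J, if x.1 = 0 then 0 else ∑ r ∈ comps x.2, F (x.1 :: r) := by
  rw [sum_ite_zero_left, sum_sigma']
  symm
  refine sum_bij (fun z _ => z.1.1 :: z.2) ?_ ?_ ?_ ?_
  · rintro ⟨⟨i, j⟩, r⟩ h
    simp only [mem_sigma, mem_comps, mem_filter,
      HasAntidiagonal.mem_antidiagonal] at h ⊢
    obtain ⟨⟨rfl, h0⟩, rfl, h⟩ := h
    exact ⟨List.sum_cons, by simpa [Nat.pos_iff_ne_zero, h0] using h⟩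
  · rintro ⟨⟨i, j⟩, r⟩ h ⟨⟨i', j'⟩, r'⟩ h' e
    simp only [mem_sigma, mem_comps] at h h'
    obtain ⟨-, rfl, -⟩ := h
    obtain ⟨-, rfl, -⟩ := h'
    simp only [List.cons.injEq] at e
    obtain ⟨rfl, rfl⟩ := e
    rfl
  · rintro n h
    rcases n with _ | ⟨i, r⟩
    · exact absurd rfl (ne_nil_of_mem_comps hJ h)
    · rw [mem_comps] at h
      refine ⟨⟨(i, r.sum), r⟩, ?_, rfl⟩
      simp only [mem_sigma, mem_comps, mem_filter,
      HasAntidiagonal.mem_antidiagonal]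
      exact ⟨⟨by simpa using h.1, (h.2 i (by simp)).ne'⟩, trivial, fun j hj => h.2 j (by simp [hj])⟩
  · intros; rfl

/-- Reversal permutes compositions. This form is needed because the recursion for `β` singles out
the last entry. -/
theorem sum_comps_snoc {J : ℕ} (hJ : J ≠ 0) (F : List ℕ → M) :
    ∑ n ∈ comps J, F n =
      ∑ x ∈ antidiagonal J, if x.1 = 0 then 0 else ∑ r ∈ comps x.2, F (r ++ [x.1]) := by
  have h : ∑ n ∈ comps J, F n = ∑ n ∈ comps J, F n.reverse := by
    refine sum_nbij' List.reverse List.reverse ?_ ?_ ?_ ?_ ?_ <;> simp [mem_comps]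
  have h' : ∀ j (i : ℕ), ∑ r ∈ comps j, F (r ++ [i]) = ∑ r ∈ comps j, F (r.reverse ++ [i]) := by
    intro j i
    refine sum_nbij' List.reverse List.reverse ?_ ?_ ?_ ?_ ?_ <;> simp [mem_comps]
  rw [h, sum_comps_cons hJ]
  simp only [h', List.reverse_cons]

theorem sum_antidiagonal_assoc (n : ℕ) (F : ℕ → ℕ → ℕ → M) :
    ∑ x ∈ antidiagonal n, ∑ y ∈ antidiagonal x.1, F y.1 y.2 x.2 =
      ∑ x ∈ antidiagonal n, ∑ y ∈ antidiagonal x.2, F x.1 y.1 y.2 := by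
  rw [sum_sigma', sum_sigma']
  refine sum_nbij' (fun z => ⟨(z.2.1, z.2.2 + z.1.2), (z.2.2, z.1.2)⟩)
    (fun z => ⟨(z.1.1 + z.2.1, z.2.2), (z.1.1, z.2.1)⟩) ?_ ?_ ?_ ?_ ?_
  · rintro ⟨⟨a, b⟩, c, d⟩ h
    simp only [mem_sigma, HasAntidiagonal.mem_antidiagonal] at h ⊢
    exact ⟨by omega, trivial⟩
  · rintro ⟨⟨a, b⟩, c, d⟩ h
    simp only [mem_sigma, HasAntidiagonal.mem_antidiagonal] at h ⊢
    exact ⟨by omega, trivial⟩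
  · rintro ⟨⟨a, b⟩, c, d⟩ h
    simp only [mem_sigma, HasAntidiagonal.mem_antidiagonal] at h ⊢
    obtain ⟨rfl, rfl⟩ := h
    rfl
  · rintro ⟨⟨a, b⟩, c, d⟩ h
    simp only [mem_sigma, HasAntidiagonal.mem_antidiagonal] at h ⊢
    obtain ⟨rfl, rfl⟩ := h
    rfl
  · intros; rfl

/-! ### Splittings -/

theorem split_nil : split [] = {[]} := by
  ext p
  rw [mem_split, mem_singleton]
  constructor
  · rintro ⟨h, h'⟩
    rcases p with _ | ⟨m, p⟩
    · rfl
    · simp only [List.flatten_cons, List.append_eq_nil_iff] at h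
      exact absurd h.1 (h' m (by simp))
  · rintro rfl
    simp

theorem sum_split_cons {l : List ℕ} (hl : l ≠ []) (F : List (List ℕ) → M) :
    ∑ p ∈ split l, F p =
      ∑ c ∈ cuts l, if c.1 = [] then 0 else ∑ p ∈ split c.2, F (c.1 :: p) := by
  rw [sum_ite_zero_left, sum_sigma']
  symm
  refine sum_bij (fun z _ => z.1.1 :: z.2) ?_ ?_ ?_ ?_
  · rintro ⟨⟨q, r⟩, p⟩ h
    simp only [mem_sigma, mem_cuts, mem_filter, mem_split] at h ⊢
    obtain ⟨⟨rfl, h0⟩, rfl, h⟩ := h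
    exact ⟨List.flatten_cons, by simpa [h0] using h⟩
  · rintro ⟨⟨q, r⟩, p⟩ h ⟨⟨q', r'⟩, p'⟩ h' e
    simp only [mem_sigma, mem_split] at h h'
    obtain ⟨-, rfl, -⟩ := h
    obtain ⟨-, rfl, -⟩ := h'
    simp only [List.cons.injEq] at e
    obtain ⟨rfl, rfl⟩ := e
    rfl
  · rintro p h
    rw [mem_split] at h
    rcases p with _ | ⟨q, p⟩
    · exact absurd h.1.symm hl
    · refine ⟨⟨(q, p.flatten), p⟩, ?_, rfl⟩
      simp only [mem_sigma, mem_cuts, mem_filter, mem_split]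
      exact ⟨⟨by simpa using h.1, h.2 q (by simp)⟩, trivial, fun m hm => h.2 m (by simp [hm])⟩
  · intros; rfl

theorem sum_sum_of_mem_split {l : List ℕ} {p : List (List ℕ)} (h : p ∈ split l) :
    (p.map List.sum).sum = l.sum := by
  rw [← (mem_split.1 h).1, List.sum_flatten]

theorem length_le_of_mem_split {l : List ℕ} {p : List (List ℕ)} (h : p ∈ split l) :
    p.length ≤ l.length := by
  obtain ⟨rfl, hp⟩ := mem_split.1 h
  rw [List.length_flatten]
  refine (List.length_map (as := p) List.length).symm.trans_le ?_
  exact List.length_le_sum_of_one_le _ fun i hi => by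
    obtain ⟨m, hm, rfl⟩ := List.mem_map.1 hi
    exact List.length_pos_iff.2 (hp m hm)

theorem length_pos_of_mem_split {l : List ℕ} (hl : l ≠ []) {p : List (List ℕ)} (h : p ∈ split l) :
    0 < p.length := by
  rw [List.length_pos_iff]
  rintro rfl
  exact hl (mem_split.1 h).1.symm

/-- The number of blocks of a splitting of a nonempty tuple lies automatically in the range of `t`,
so grading by it can be forgotten. -/
theorem sum_split_length {l : List ℕ} (hl : l ≠ []) (F : List (List ℕ) → M) :
    ∑ t ∈ Icc 1 l.length, ∑ p ∈ split l with p.length = t, F p = ∑ p ∈ split l, F p :=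
  sum_fiberwise_of_maps_to
    (fun _ hp => mem_Icc.2 ⟨length_pos_of_mem_split hl hp, length_le_of_mem_split hp⟩) F

/-! ### Inverting the binomial coefficients -/

/-- The alternating sum of the `coeffB k p` over the splittings `p` of a tuple. -/
def coeffV (k : ℕ) (m : List ℕ) : ℚ := ∑ p ∈ split m, (-1) ^ p.length * (coeffB k p : ℚ)

theorem coeffV_nil (k : ℕ) : coeffV k [] = 1 := by simp [coeffV, split_nil, coeffB]

/-- Only the sign convention differs. At the empty tuple the two disagree: `coeffU` is an empty sum,
while `coeffV` is `1`, the value that makes the inversion below uniform. -/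
theorem coeffU_eq {m : List ℕ} (hm : m ≠ []) (k : ℕ) : coeffU m k = -coeffV k m := by
  rw [coeffU, coeffV, ← sum_split_length hm, ← sum_neg_distrib]
  refine sum_congr rfl fun i hi => ?_
  rw [mul_sum, ← sum_neg_distrib]
  refine sum_congr rfl fun p hp => ?_
  obtain ⟨j, rfl⟩ := Nat.exists_eq_add_of_le' (mem_Icc.1 hi).1
  rw [(mem_filter.1 hp).2, Nat.add_sub_cancel, pow_succ]
  ring

/-- Sorting the splittings of a nonempty `m` by their first block expresses `coeffV k m` as minus
the sum of the terms with nonempty first part. The cut with empty first part contributes `coeffV k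
m` itself, and the two cancel. -/
theorem sum_choose_mul_coeffV (k : ℕ) (m : List ℕ) :
    ∑ c ∈ cuts m, ((c.2.sum + k).choose c.1.length : ℚ) * coeffV k c.2 =
      if m = [] then 1 else 0 := by
  split_ifs with hm
  · subst hm
    simp [cuts_nil, coeffV_nil]
  have h : coeffV k m = ∑ c ∈ cuts m, if c.1 = [] then 0 else
      -(((c.2.sum + k).choose c.1.length : ℚ) * coeffV k c.2) := by
    rw [coeffV, sum_split_cons hm]
    refine sum_congr rfl fun c hc => ?_
    split_ifs with h
    · rfl
    rw [coeffV, mul_sum, ← sum_neg_distrib]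
    refine sum_congr rfl fun p hp => ?_
    rw [coeffB, sum_sum_of_mem_split hp, List.length_cons, pow_succ]
    push_cast
    ring
  -- The only cut with empty first part is `([], m)`, and its binomial coefficient is `1`.
  have h' : coeffV k m = ∑ c ∈ cuts m, if c.1 = [] then
      (((c.2.sum + k).choose c.1.length : ℚ) * coeffV k c.2) else 0 := by
    have : ∀ c ∈ cuts m, c ≠ ([], m) → c.1 ≠ [] := by
      rintro ⟨q, r⟩ hc hne rfl
      exact hne (by rw [← mem_cuts.1 hc]; rfl)
    rw [sum_eq_single ([], m) (fun c hc hne => if_neg (this c hc hne))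
      (fun h => absurd (mem_cuts.2 rfl) h)]
    simp
  have h2 := sub_eq_zero.2 (h'.symm.trans h)
  rw [← sum_sub_distrib] at h2
  rw [← h2]
  refine sum_congr rfl fun c _ => ?_
  split_ifs <;> ring

/-! ### The coefficients `A` and `β` in recursive form -/

theorem coeffA_nil : coeffA [] = 1 := by simp [coeffA]

theorem coeffA_cons (q : List ℕ) (p : List (List ℕ)) :
    coeffA (q :: p) = 1 / (q.length.factorial * ((q.sum : ℚ) + 1)) * coeffA p := by
  simp only [coeffA, List.map_cons, List.prod_cons]
  rw [one_div_mul_eq_div, one_div_mul_eq_div, one_div_mul_eq_div, one_div_mul_eq_div, div_div,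
    div_div]
  congr 1
  ring

/-- With `coeffV` in place of `coeffU`, the initial value `-1` becomes the case `l = []`, where the
empty splitting contributes `1`. -/
theorem coeffBeta_append (l : List ℕ) (k : ℕ) :
    coeffBeta (l ++ [k]) = -∑ p ∈ split l, coeffV k (p.map List.sum) * coeffA p := by
  by_cases hl : l = []
  · subst hl
    simp [coeffBeta, split_nil, coeffV_nil, coeffA_nil]
  have hlen : ¬ (l ++ [k]).length ≤ 1 := by
    have := List.length_pos_iff.2 hl
    simp only [List.length_append, List.length_singleton]
    omega
  rw [coeffBeta, if_neg hlen, List.dropLast_concat]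
  simp only [List.length_append, List.length_singleton, Nat.add_sub_cancel]
  rw [sum_split_length hl, ← sum_neg_distrib]
  refine sum_congr rfl fun p hp => ?_
  have : p.map List.sum ≠ [] := by
    have := length_pos_of_mem_split hl hp
    rintro h
    simp [List.map_eq_nil_iff.1 h] at this
  rw [coeffU_eq this]
  simp

end Combinatorics

end ConnesMoscovici

namespace PowerSeries

/-! ### Power series -/

section Antipode

open Finset
open ConnesMoscovici (comps mem_comps comps_zero ne_nil_of_mem_comps sum_comps_cons)
open scoped Nat

variable {R : Type*} [CommRing R]

/-- Without a constant term each of the `l` factors contributes a positive exponent, so the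
exponents form a composition of length `l`. -/
theorem coeff_pow_eq_sum_comps {g : R⟦X⟧} (hg : coeff 0 g = 0) (l J : ℕ) :
    coeff J (g ^ l) =
      ∑ q ∈ comps J, if q.length = l then (q.map fun i => coeff i g).prod else 0 := by
  induction l generalizing J with
  | zero =>
    rw [pow_zero, coeff_one]
    split_ifs with hJ
    · subst hJ
      simp [comps_zero]
    · refine (sum_eq_zero fun q hq => if_neg ?_).symm
      exact fun h => ne_nil_of_mem_comps hJ hq (List.length_eq_zero_iff.1 h)
  | succ l ih =>
    rw [pow_succ', coeff_mul]
    by_cases hJ : J = 0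
    · subst hJ
      simp [comps_zero, hg]
    rw [sum_comps_cons hJ]
    refine sum_congr rfl fun x _ => ?_
    split_ifs with hx
    · rw [hx, hg, zero_mul]
    · rw [ih, mul_sum]
      refine sum_congr rfl fun q _ => ?_
      simp

theorem coeff_one_add_pow {g : R⟦X⟧} (hg : coeff 0 g = 0) (n J : ℕ) :
    coeff J ((1 + g) ^ n) =
      ∑ q ∈ comps J, (n.choose q.length : R) * (q.map fun i => coeff i g).prod := by
  rw [add_comm, add_pow, map_sum]
  have h : ∀ l, coeff J (g ^ l * 1 ^ (n - l) * (n.choose l : R⟦X⟧)) = ∑ q ∈ comps J,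
      if q.length = l then (n.choose l : R) * (q.map fun i => coeff i g).prod else 0 := by
    intro l
    rw [one_pow, mul_one, mul_comm, ← map_natCast (C (R := R)), coeff_C_mul,
      coeff_pow_eq_sum_comps hg, mul_sum]
    simp only [mul_ite, mul_zero]
  simp only [h]
  rw [sum_comm]
  refine sum_congr rfl fun q _ => ?_
  rw [sum_ite_eq]
  split_ifs with hq
  · rfl
  -- Compositions longer than `n` do not occur in the binomial expansion, and their binomial
  -- coefficient vanishes.
  · rw [Nat.choose_eq_zero_of_lt (by simpa using hq), Nat.cast_zero, zero_mul]

theorem eq_zero_of_forall_X_pow_dvd {g : R⟦X⟧} (h : ∀ n, X ^ n ∣ g) : g = 0 := by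
  ext n
  exact X_pow_dvd_iff.1 (h (n + 1)) n n.lt_succ_self

/-! ### Exponentials and derivations -/

variable [Algebra ℚ R]

/-- Every derivation is `X`-adically continuous: by the Leibniz rule it lowers the order by at most
one, whatever `D X` is. -/
theorem X_pow_dvd_derivation (D : Derivation ℚ R⟦X⟧ R⟦X⟧) {n : ℕ} {g : R⟦X⟧}
    (h : X ^ (n + 1) ∣ g) : X ^ n ∣ D g := by
  obtain ⟨g, rfl⟩ := h
  rw [D.leibniz, D.leibniz_pow, Nat.add_sub_cancel]
  refine dvd_add ?_ ?_
  · exact Dvd.dvd.mul_right (pow_dvd_pow _ n.le_succ) _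
  · rw [smul_eq_mul, nsmul_eq_mul, smul_eq_mul]
    exact ⟨g * ((n + 1 : ℕ) * D X), by ring⟩

/-- The exponential of a power series without constant term. -/
noncomputable def expSeries (f : R⟦X⟧) : R⟦X⟧ :=
  mk fun j => ∑ l ∈ range (j + 1), (l ! : ℚ)⁻¹ • coeff j (f ^ l)

/-- Since `X` divides `f`, the powers `f ^ l` with `l > j` do not reach the coefficient of degree
`j`. -/
theorem X_pow_dvd_expSeries_sub {f : R⟦X⟧} (hf : coeff 0 f = 0) (n : ℕ) :
    X ^ n ∣ expSeries f - ∑ l ∈ range n, (l ! : ℚ)⁻¹ • f ^ l := by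
  rw [X_pow_dvd_iff]
  intro j hj
  rw [map_sub, expSeries, coeff_mk, sub_eq_zero, map_sum]
  refine sum_subset_zero_on_sdiff (range_mono hj) (fun l hl => ?_) fun l _ => ?_
  · have hl' : j < l := by simp at hl; exact hl.2
    have : X ∣ f := X_dvd_iff.2 (by rwa [← coeff_zero_eq_constantCoeff_apply])
    rw [coeff_smul, X_pow_dvd_iff.1 (pow_dvd_pow_of_dvd this l) j (by grind), smul_zero]
  · rw [coeff_smul]

/-- Modulo each `X ^ n` the exponential is a partial sum, on which the rule is the Leibniz rule for
powers. It serves both for the formal derivative and for `coeffwise D`. -/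
theorem derivation_expSeries (D : Derivation ℚ R⟦X⟧ R⟦X⟧) {f : R⟦X⟧} (hf : coeff 0 f = 0) :
    D (expSeries f) = D f * expSeries f := by
  rw [← sub_eq_zero]
  refine eq_zero_of_forall_X_pow_dvd fun n => ?_
  -- One more term is taken here: `D` costs one power of `X` and lowers the exponents in the partial
  -- sum by one.
  have h1 := X_pow_dvd_derivation D (X_pow_dvd_expSeries_sub hf (n + 1))
  have h2 := (X_pow_dvd_expSeries_sub hf n).mul_left (D f)
  have h3 : D (∑ l ∈ range (n + 1), (l ! : ℚ)⁻¹ • f ^ l) =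
      D f * ∑ l ∈ range n, (l ! : ℚ)⁻¹ • f ^ l := by
    rw [map_sum, sum_range_succ', mul_sum]
    simp only [pow_zero, D.map_smul, D.map_one_eq_zero, smul_zero, add_zero]
    refine sum_congr rfl fun l _ => ?_
    rw [D.leibniz_pow, Nat.add_sub_cancel, Nat.factorial_succ, ← Nat.cast_smul_eq_nsmul ℚ,
      smul_smul, smul_eq_mul, mul_smul_comm, mul_comm (D f)]
    congr 1
    have : (l ! : ℚ) ≠ 0 := by positivity
    push_cast
    field_simp
  rw [map_sub, h3] at h1
  convert dvd_sub h1 h2 using 1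
  ring

theorem coeff_expSeries {f : R⟦X⟧} (hf : coeff 0 f = 0) (J : ℕ) :
    coeff J (expSeries f) =
      ∑ q ∈ comps J, (q.length ! : ℚ)⁻¹ • (q.map fun i => coeff i f).prod := by
  rw [expSeries, coeff_mk]
  simp only [coeff_pow_eq_sum_comps hf, smul_sum]
  rw [sum_comm]
  refine sum_congr rfl fun q hq => ?_
  simp only [smul_ite, smul_zero]
  rw [sum_ite_eq, if_pos]
  obtain ⟨h, h'⟩ := mem_comps.1 hq
  rw [mem_range, Nat.lt_succ_iff, ← h]
  exact List.length_le_sum_of_one_le _ h'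

/-- The extension of a derivation to power series, coefficient by coefficient. -/
noncomputable def coeffwise (D : Derivation ℚ R R) : Derivation ℚ R⟦X⟧ R⟦X⟧ :=
  Derivation.mk'
    { toFun := fun g => mk fun n => D (coeff n g)
      map_add' := fun g h => by ext n; simp
      map_smul' := fun c g => by ext n; simp }
    fun g h => by
      ext n
      simp only [LinearMap.coe_mk, AddHom.coe_mk, coeff_mk, coeff_mul, map_sum, D.leibniz,
        map_add, smul_eq_mul, sum_add_distrib]
      rw [← Nat.sum_antidiagonal_swap (f := fun x => coeff x.1 h * D (coeff x.2 g))]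
      rfl

@[simp] theorem coeff_coeffwise (D : Derivation ℚ R R) (g : R⟦X⟧) (n : ℕ) :
    coeff n (coeffwise D g) = D (coeff n g) :=
  coeff_mk n fun n => D (coeff n g)

theorem coeffwise_C (D : Derivation ℚ R R) (r : R) : coeffwise D (C r) = C (D r) := by
  ext n
  rw [coeff_coeffwise, coeff_C, coeff_C]
  split_ifs <;> simp

/-- `∫ exp f / X`. -/
noncomputable def intExp (f : R⟦X⟧) : R⟦X⟧ :=
  mk fun j => ((j : ℚ) + 1)⁻¹ • coeff j (expSeries f)

theorem derivative_X_mul_intExp (f : R⟦X⟧) : derivative R (X * intExp f) = expSeries f := by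
  ext j
  rw [coeff_derivative, coeff_succ_X_mul, intExp, coeff_mk, mul_comm, ← Nat.cast_succ,
    ← nsmul_eq_mul, ← Nat.cast_smul_eq_nsmul ℚ, smul_smul, Nat.cast_succ, mul_inv_cancel₀,
    one_smul]
  positivity

theorem coeffwise_derivative (D : Derivation ℚ R R) (g : R⟦X⟧) :
    derivative R (coeffwise D g) = coeffwise D (derivative R g) := by
  ext n
  rw [coeff_derivative, coeff_coeffwise, coeff_coeffwise, coeff_derivative, D.leibniz,
    ← Nat.cast_succ, D.map_natCast]
  simp [mul_comm]

theorem coeff_zero_expSeries (f : R⟦X⟧) : coeff 0 (expSeries f) = 1 := by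
  simp [expSeries]

/-! ### The differential equation and its unique solution -/

variable {D : Derivation ℚ R R} {f : R⟦X⟧} {d : R}

/-- Both sides have constant term `1` and derivative `f' * exp f`: on the right, `d * exp f` and `D
(exp f) = (f' - d) * exp f` add up to it. -/
theorem expSeries_eq (hf : coeff 0 f = 0) (hD : coeffwise D f = derivative R f - C d) :
    expSeries f = 1 + C d * (X * intExp f) + coeffwise D (X * intExp f) := by
  have : IsAddTorsionFree R := IsAddTorsionFree.of_module_rat R
  refine derivative.ext ?_ ?_
  · have h := derivation_expSeries ((derivative R).restrictScalars ℚ) hf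
    simp only [Derivation.restrictScalars_apply] at h
    rw [map_add, map_add, coeffwise_derivative, Derivation.leibniz, derivative_C,
      derivative_X_mul_intExp, derivation_expSeries _ hf, hD, derivative_one, h]
    simp only [smul_eq_mul]
    ring
  · have h := coeff_coeffwise D (X * intExp f) 0
    rw [coeff_zero_X_mul, map_zero, coeff_zero_eq_constantCoeff_apply] at h
    have h' := coeff_zero_expSeries f
    rw [coeff_zero_eq_constantCoeff_apply] at h'
    simp only [map_add, h, h']
    simp

/-- Let `g = X * intExp f`. By `g' = 1 + d g + D g` and `hs`, the term of index `n ≥ 1` contributes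
`(n + 1) s (n + 1) g ^ n - n s n g ^ (n - 1)`. The sum telescopes, leaving the top term and `-s 1 =
d`. -/
theorem sum_mul_pow_ode (hf : coeff 0 f = 0) (hD : coeffwise D f = derivative R f - C d)
    {s : ℕ → R} (h0 : s 0 = 0) (h1 : s 1 = -d)
    (hs : ∀ n, D (s (n + 1)) = (n + 2) * s (n + 2) + (n + 1) * d * s (n + 1)) (N : ℕ) :
    coeffwise D (∑ n ∈ range (N + 1), C (s n) * (X * intExp f) ^ n) -
      derivative R (∑ n ∈ range (N + 1), C (s n) * (X * intExp f) ^ n) =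
      C ((N + 1) * s (N + 1)) * (X * intExp f) ^ N + C d := by
  have hg := expSeries_eq hf hD
  rw [← derivative_X_mul_intExp] at hg
  generalize X * intExp f = g at *
  induction N with
  | zero => simp [h0, h1]
  | succ N ih =>
    rw [sum_range_succ, map_add, map_add, add_sub_add_comm, ih, Derivation.leibniz,
      Derivation.leibniz, Derivation.leibniz_pow, Derivation.leibniz_pow, hg, derivative_C,
      coeffwise_C, hs]
    simp only [smul_eq_mul, nsmul_eq_mul, map_add, map_mul, map_natCast, map_one, map_ofNat,
      Nat.add_sub_cancel]
    push_cast
    ring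

/-- The truncated sum plus `f` is a series `h` without constant term such that `D h - h'` is
divisible by `X ^ m`. Hence for `j < m` its coefficient of degree `j + 1` is `D` of the one of
degree `j` divided by `j + 1`, and all coefficients up to degree `m` vanish. -/
theorem sum_mul_coeff_pow (hf : coeff 0 f = 0) (hD : coeffwise D f = derivative R f - C d)
    {s : ℕ → R} (h0 : s 0 = 0) (h1 : s 1 = -d)
    (hs : ∀ n, D (s (n + 1)) = (n + 2) * s (n + 2) + (n + 1) * d * s (n + 1)) (m : ℕ) :
    ∑ x ∈ antidiagonal m, s x.1 * coeff x.2 (intExp f ^ x.1) = -coeff m f := by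
  set h := ∑ n ∈ range (m + 1), C (s n) * (X * intExp f) ^ n + f with hh
  have ode : coeffwise D h - derivative R h = C ((m + 1) * s (m + 1)) * (X * intExp f) ^ m := by
    rw [hh, map_add, map_add, add_sub_add_comm, sum_mul_pow_ode hf hD h0 h1 hs, hD]
    ring
  have key : ∀ j ≤ m, coeff j h = 0 := by
    intro j
    induction j with
    | zero =>
      intro _
      rw [hh, map_add, hf, add_zero, map_sum]
      refine sum_eq_zero fun n _ => ?_
      rcases n with _ | n <;> simp [h0]
    | succ j ih =>
      intro hj
      have h2 := congrArg (coeff j) ode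
      rw [map_sub, coeff_coeffwise, ih (by omega), map_zero, zero_sub, coeff_derivative,
        mul_pow, mul_left_comm, X_pow_dvd_iff.1 (dvd_mul_right _ _) j hj, neg_eq_zero, mul_comm,
        ← Nat.cast_succ, ← nsmul_eq_mul, ← Nat.cast_smul_eq_nsmul ℚ] at h2
      have h3 := congrArg (fun z => ((j.succ : ℚ))⁻¹ • z) h2
      rwa [← mul_smul, inv_mul_cancel₀ (by positivity), one_smul, smul_zero] at h3
  have h4 := key m le_rfl
  rw [hh, map_add, map_sum] at h4
  rw [Nat.sum_antidiagonal_eq_sum_range_succ_mk, ← add_eq_zero_iff_eq_neg, ← h4]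
  congr 1
  refine sum_congr rfl fun n hn => ?_
  rw [coeff_C_mul, mul_pow, coeff_X_pow_mul', if_pos (by grind)]

end Antipode

end PowerSeries

namespace ConnesMoscovici

/-! ### Inverting the linear system and solving the recursion -/

section Inversion

open Finset
open PowerSeries (coeff mk C expSeries intExp coeffwise derivative)
open scoped Nat PowerSeries

/-- A unitriangular system has at most one solution: in equation `m` the unknown of index `m` has
coefficient `M m 0 = 1`. -/
theorem eq_of_sum_antidiagonal_eq {R : Type*} [CommRing R] {x y : ℕ → R} {M : ℕ → ℕ → R} (hM : ∀ n, M n 0 = 1)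
    (h : ∀ m, ∑ z ∈ antidiagonal m, x z.1 * M z.1 z.2 = ∑ z ∈ antidiagonal m, y z.1 * M z.1 z.2)
    (m : ℕ) : x m = y m := by
  induction m using Nat.strong_induction_on with
  | _ m ih =>
  have h' := h m
  rw [Nat.sum_antidiagonal_eq_sum_range_succ_mk, Nat.sum_antidiagonal_eq_sum_range_succ_mk,
    sum_range_succ, sum_range_succ, Nat.sub_self, hM, mul_one, mul_one] at h'
  rw [sum_congr rfl fun i hi => by rw [ih i (mem_range.1 hi)]] at h'
  exact add_left_cancel h'

variable {R : Type*} [CommRing R] [Algebra ℚ R]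

/-- This exhibits the inverse of the matrix of coefficients of the powers of `1 + g`. Expanding the
power, every composition of `J` gets as weight the sum over its cuts in `sum_choose_mul_coeffV`, so
only the empty one survives. -/
theorem sum_coeffV_mul_coeff_pow {g : R⟦X⟧} (hg : coeff 0 g = 0) (k J : ℕ) :
    ∑ x ∈ antidiagonal J, (∑ m ∈ comps x.1, coeffV k m • (m.map fun i => coeff i g).prod) *
      coeff x.2 ((1 + g) ^ (k + x.1)) = if J = 0 then 1 else 0 := by
  have h : ∀ x ∈ antidiagonal J, (∑ m ∈ comps x.1, coeffV k m • (m.map fun i => coeff i g).prod) *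
      coeff x.2 ((1 + g) ^ (k + x.1)) = ∑ q ∈ comps x.2, ∑ r ∈ comps x.1,
        (((r.sum + k).choose q.length : ℚ) * coeffV k r) •
          ((q ++ r).map fun i => coeff i g).prod := by
    intro x _
    rw [PowerSeries.coeff_one_add_pow hg, sum_mul_sum, sum_comm]
    refine sum_congr rfl fun q _ => sum_congr rfl fun r hr => ?_
    rw [(mem_comps.1 hr).1, List.map_append, List.prod_append, add_comm k, mul_comm (Nat.cast _),
      mul_smul, smul_mul_assoc, Nat.cast_smul_eq_nsmul, nsmul_eq_mul, mul_smul_comm]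
    congr 1
    ring
  -- The swap puts the composition `q` coming from the power in front of `r`, as a first block whose
  -- binomial depends on the sum of what follows.
  rw [sum_congr rfl h, ← Nat.sum_antidiagonal_swap]
  simp only [Prod.fst_swap, Prod.snd_swap]
  rw [← sum_comps_cuts J fun q r => (((r.sum + k).choose q.length : ℚ) * coeffV k r) •
    ((q ++ r).map fun i => coeff i g).prod]
  have h' : ∀ n ∈ comps J, (∑ c ∈ cuts n, (((c.2.sum + k).choose c.1.length : ℚ) *
      coeffV k c.2) • ((c.1 ++ c.2).map fun i => coeff i g).prod) = if J = 0 then 1 else 0 := by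
    intro n hn
    have : ∀ c ∈ cuts n, (((c.2.sum + k).choose c.1.length : ℚ) *
      coeffV k c.2) • ((c.1 ++ c.2).map fun i => coeff i g).prod =
      (((c.2.sum + k).choose c.1.length : ℚ) *
      coeffV k c.2) • (n.map fun i => coeff i g).prod := fun c hc => by rw [mem_cuts.1 hc]
    rw [sum_congr rfl this, ← sum_smul, sum_choose_mul_coeffV]
    by_cases hJ : J = 0
    · subst hJ
      rw [comps_zero, mem_singleton] at hn
      simp [hn]
    · rw [if_neg (ne_nil_of_mem_comps hJ hn), if_neg hJ, zero_smul]
  rw [sum_congr rfl h']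
  by_cases hJ : J = 0
  · subst hJ
    simp [comps_zero]
  · simp [hJ]

/-- Replacing each entry of a composition `m` by a composition of that entry gives a composition `l`
with a splitting whose block sums are `m`; the weights multiply to `coeffA`. The weight `G` is
arbitrary so that the induction can absorb the first entry into it. -/
theorem sum_comps_smul_prod {a p : ℕ → R} (hp : ∀ i ≠ 0, p i = ∑ q ∈ comps i,
    (1 / (q.length ! * ((i : ℚ) + 1))) • (q.map a).prod) (j : ℕ) (G : List ℕ → ℚ) :
    ∑ m ∈ comps j, G m • (m.map p).prod =
      ∑ l ∈ comps j, (∑ c ∈ split l, G (c.map List.sum) * coeffA c) • (l.map a).prod := by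
  induction j using Nat.strong_induction_on generalizing G with
  | _ j ih =>
  by_cases hj : j = 0
  · subst hj
    simp [comps_zero, split_nil, coeffA_nil]
  have h : ∀ l ∈ comps j, (∑ c ∈ split l, G (c.map List.sum) * coeffA c) • (l.map a).prod =
      ∑ x ∈ cuts l, if x.1 = [] then 0 else
        ((1 / (x.1.length ! * ((x.1.sum : ℚ) + 1))) • (x.1.map a).prod) *
        ((∑ c ∈ split x.2, G (x.1.sum :: c.map List.sum) * coeffA c) • (x.2.map a).prod) := by
    intro l hl
    rw [sum_split_cons (ne_nil_of_mem_comps hj hl), sum_smul]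
    refine sum_congr rfl fun x hx => ?_
    split_ifs
    · rw [zero_smul]
    · rw [← mem_cuts.1 hx, List.map_append, List.prod_append, smul_mul_smul_comm, mul_sum]
      congr 1
      refine sum_congr rfl fun c _ => ?_
      rw [coeffA_cons, List.map_cons]
      ring
  rw [sum_comps_cons hj, sum_congr rfl h, sum_comps_cuts j fun q r => if q = [] then 0 else
        ((1 / (q.length ! * ((q.sum : ℚ) + 1))) • (q.map a).prod) *
        ((∑ c ∈ split r, G (q.sum :: c.map List.sum) * coeffA c) • (r.map a).prod)]
  refine sum_congr rfl fun x hx => ?_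
  rw [HasAntidiagonal.mem_antidiagonal] at hx
  split_ifs with h0
  · rw [h0, comps_zero]
    simp
  · have h1 : ∀ m, G (x.1 :: m) • ((x.1 :: m).map p).prod =
        p x.1 * (G (x.1 :: m) • (m.map p).prod) := by
      intro m
      rw [List.map_cons, List.prod_cons, mul_smul_comm]
    simp only [h1]
    rw [← mul_sum, ih x.2 (by omega) fun m => G (x.1 :: m), hp _ h0, sum_mul_sum]
    refine sum_congr rfl fun q hq => sum_congr rfl fun r hr => ?_
    rw [if_neg (ne_nil_of_mem_comps h0 hq), (mem_comps.1 hq).1]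

theorem prod_map_smul (c : ℕ → ℚ) (d : ℕ → R) (l : List ℕ) :
    (l.map fun i => c i • d i).prod = (l.map c).prod • (l.map d).prod := by
  induction l with
  | nil => simp
  | cons i l ih =>
    simp only [List.map_cons, List.prod_cons, ih, smul_mul_smul_comm]

/-- The solution of the recursion that the antipode satisfies. -/
theorem recursion_solution (D : Derivation ℚ R R) {d s : ℕ → R} (hd0 : d 0 = 0)
    (hd : ∀ n, D (d (n + 1)) = d (n + 2)) (hs0 : s 0 = 0) (hs1 : s 1 = -d 1)
    (hs : ∀ n : ℕ, s (n + 2) = D (s (n + 1)) - ((n : R) + 1) * d 1 * s (n + 1)) {n : ℕ}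
    (hn : n ≠ 0) :
    s n = ∑ c : Composition n, ((n ! : ℚ) / (c.blocks.map fun i => (i ! : ℚ)).prod *
      coeffBeta c.blocks) • (c.blocks.map d).prod := by
  set a : ℕ → R := fun i => (i ! : ℚ)⁻¹ • d i with ha
  set f : R⟦X⟧ := mk a with hf
  have hfc : ∀ i, coeff i f = a i := fun i => PowerSeries.coeff_mk _ _
  have hf0 : coeff 0 f = 0 := by rw [hfc, ha]; simp [hd0]
  have succ_mul : ∀ (n : ℕ) (r : R), ((n : R) + 1) * r = ((n : ℚ) + 1) • r := fun n r => by
    rw [← Nat.cast_succ, ← Nat.cast_succ, Nat.cast_smul_eq_nsmul, nsmul_eq_mul]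
  have fact : ∀ (n : ℕ) (r : R),
      ((n : R) + 1) * (((n + 1)! : ℚ)⁻¹ • r) = (n ! : ℚ)⁻¹ • r := fun n r => by
    rw [succ_mul, smul_smul, Nat.factorial_succ]
    congr 1
    have : (n ! : ℚ) ≠ 0 := by positivity
    push_cast
    field_simp
  have hD : coeffwise D f = derivative R f - C (d 1) := by
    ext n
    rw [PowerSeries.coeff_coeffwise, map_sub, PowerSeries.coeff_derivative, PowerSeries.coeff_C,
      hfc, hfc, mul_comm, ha]
    simp only [fact, D.map_smul]
    -- In degree `0` the left side vanishes because `d 0 = 0`; the term `C (d 1)` compensates for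
    -- this.
    rcases n with _ | n
    · simp [hd0]
    · simp [hd]
  have key := PowerSeries.sum_mul_coeff_pow hf0 hD (s := fun i => (i ! : ℚ)⁻¹ • s i)
    (by simp [hs0]) (by simp [hs1]) (fun n => by
      have := fact (n + 1) (s (n + 2))
      rw [Nat.cast_succ, add_assoc, one_add_one_eq_two] at this
      rw [this, D.map_smul, hs, mul_smul_comm, ← smul_add]
      congr 1
      ring)
  set g := intExp f - 1 with hg
  have hg1 : intExp f = 1 + g := by rw [hg]; ring
  have hgc : ∀ i ≠ 0, coeff i g = ∑ q ∈ comps i,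
      (1 / (q.length ! * ((i : ℚ) + 1))) • (q.map a).prod := by
    intro i hi
    rw [hg, map_sub, PowerSeries.coeff_one, if_neg hi, sub_zero, intExp, PowerSeries.coeff_mk,
      PowerSeries.coeff_expSeries hf0, smul_sum]
    simp only [hfc]
    refine sum_congr rfl fun q _ => ?_
    rw [smul_smul, one_div, mul_inv, mul_comm]
  have hg0 : coeff 0 g = 0 := by
    rw [hg, map_sub, intExp, PowerSeries.coeff_mk, PowerSeries.coeff_zero_expSeries]
    simp
  rw [hg1] at key
  set W : ℕ → ℕ → R := fun k j => ∑ m ∈ comps j, coeffV k m • (m.map fun i => coeff i g).prod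
    with hW
  -- The candidate, the inverse matrix applied to `-f`, satisfies the same system. Regrouping by
  -- `y.1` isolates the sum of `sum_coeffV_mul_coeff_pow`, which leaves only `y.1 = m`.
  have key2 : ∀ m, ∑ x ∈ antidiagonal m, (-∑ y ∈ antidiagonal x.1, a y.1 * W y.1 y.2) *
      coeff x.2 ((1 + g) ^ x.1) = -coeff m f := by
    intro m
    simp only [neg_mul, sum_neg_distrib, sum_mul]
    have h : ∀ x ∈ antidiagonal m, ∀ y ∈ antidiagonal x.1,
        a y.1 * W y.1 y.2 * coeff x.2 ((1 + g) ^ x.1) =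
        a y.1 * W y.1 y.2 * coeff x.2 ((1 + g) ^ (y.1 + y.2)) := fun x _ y hy => by
      rw [HasAntidiagonal.mem_antidiagonal.1 hy]
    rw [sum_congr rfl fun x hx => sum_congr rfl (h x hx), sum_antidiagonal_assoc m
      fun k j J => a k * W k j * coeff J ((1 + g) ^ (k + j))]
    simp only [mul_assoc, ← mul_sum, hW, sum_coeffV_mul_coeff_pow hg0, hfc, neg_inj]
    rw [Nat.sum_antidiagonal_eq_sum_range_succ_mk, sum_range_succ,
      sum_eq_zero fun i hi => by rw [if_neg (by grind), mul_zero]]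
    simp
  have sol := eq_of_sum_antidiagonal_eq (M := fun n J => coeff J ((1 + g) ^ n))
    (x := fun i => (i ! : ℚ)⁻¹ • s i) (y := fun i => -∑ y ∈ antidiagonal i, a y.1 * W y.1 y.2)
    (fun n => (PowerSeries.coeff_one_add_pow hg0 n 0).trans (by simp [comps_zero]))
    (fun m => (key m).trans (key2 m).symm) n
  have hnf : (n ! : ℚ) ≠ 0 := by positivity
  have sol' : s n = (n ! : ℚ) • -∑ y ∈ antidiagonal n, a y.1 * W y.1 y.2 := by
    rw [← sol, smul_smul, mul_inv_cancel₀ hnf, one_smul]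
  have hc : ∀ l : List ℕ, ((n ! : ℚ) / (l.map fun i => (i ! : ℚ)).prod * coeffBeta l) •
      (l.map d).prod = (n ! : ℚ) • coeffBeta l • (l.map a).prod := by
    intro l
    rw [ha, prod_map_smul, smul_smul, smul_smul, div_eq_mul_inv, List.prod_inv, List.map_map]
    congr 1
    simp only [Function.comp_def]
    ring
  rw [sol', sum_composition n fun l => ((n ! : ℚ) / (l.map fun i => (i ! : ℚ)).prod *
    coeffBeta l) • (l.map d).prod]
  simp only [hc]
  -- The index `k` of `a k * W k j` becomes the last entry of the composition; `k = 0` contributes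
  -- nothing because `a 0 = 0`.
  rw [← smul_sum, sum_comps_snoc hn, ← sum_neg_distrib]
  congr 1
  refine sum_congr rfl fun x _ => ?_
  split_ifs with h0
  · rw [h0, ← hfc, hf0, zero_mul, neg_zero]
  · rw [hW]
    simp only
    rw [sum_comps_smul_prod hgc, mul_sum, ← sum_neg_distrib]
    refine sum_congr rfl fun l _ => ?_
    rw [coeffBeta_append, List.map_append, List.prod_append, neg_smul, mul_smul_comm, mul_comm]
    simp

end Inversion

/-! ### The antipode -/

section Antipode

variable (k : Type*) [Field k]

/-- The commutative ring structure of `H¹`. -/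
noncomputable abbrev commRingH1CM : CommRing (H1CM k) :=
  { (inferInstance : Ring (H1CM k)) with
    mul_comm := fun a b => Subtype.ext (H1CM_comm a.2 b.2) }

/-- The linear map `[X, ·]` on `H¹`. -/
noncomputable def adX : H1CM k →ₗ[k] H1CM k where
  toFun a := ⟨X k * a - a * X k, adX_mem a.2⟩
  map_add' a b := Subtype.ext (by simp only [Subalgebra.coe_add]; noncomm_ring)
  map_smul' c a := Subtype.ext (by
    simp only [Subalgebra.coe_smul, RingHom.id_apply, mul_smul_comm, smul_mul_assoc, smul_sub])

theorem adX_mul (a b : H1CM k) : adX k (a * b) = a * adX k b + b * adX k a := by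
  rw [show b * adX k a = adX k a * b from Subtype.ext (H1CM_comm b.2 (adX k a).2)]
  refine Subtype.ext ?_
  change X k * (a * b) - a * b * X k = a * (X k * b - b * X k) + (X k * a - a * X k) * b
  noncomm_ring

theorem adX_δH1 (n : ℕ) : adX k (δH1 k (n + 1)) = δH1 k (n + 2) :=
  Subtype.ext (comm_X_δ k n)

theorem δH1_zero : δH1 k 0 = 0 := Subtype.ext (by simp [δH1, δ, lieδ])

theorem comm_Y_antδ (n : ℕ) : Y k * antδ k n - antδ k n * Y k = ((n : k) + 1) • antδ k n := by
  rw [← antYδ]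
  noncomm_ring

theorem antipode_δH1_one : HopfAlgebra.antipode k (δH1 k 1) = -δH1 k 1 :=
  Subtype.ext (antipodeMap_δ_one k)

/-- Antimultiplicativity turns `[X, δₙ₊₁]` into `[S(δₙ₊₁), -X + δ₁ Y]`. As `δ₁` commutes with `H¹`,
this is `[X, ·] - δ₁ [Y, ·]` on `S(δₙ₊₁)`, which has weight `n + 1` under `Y`. -/
theorem antipode_δH1_add_two (n : ℕ) : HopfAlgebra.antipode k (δH1 k (n + 2)) =
    adX k (HopfAlgebra.antipode k (δH1 k (n + 1))) -
      ((n : H1CM k) + 1) * δH1 k 1 * HopfAlgebra.antipode k (δH1 k (n + 1)) := by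
  refine Subtype.ext ?_
  have h1 : ∀ n, ((HopfAlgebra.antipode k (δH1 k (n + 1)) : H1CM k) : HCM k) = antδ k n :=
    antipodeMap_δ k
  have h2 : (((n : H1CM k) + 1 : H1CM k) : HCM k) = ((n : k) + 1) • 1 := by
    rw [← Nat.cast_succ, ← Nat.cast_succ, Nat.cast_smul_eq_nsmul, nsmul_one]
    rfl
  change ((HopfAlgebra.antipode k (δH1 k (n + 1 + 1)) : H1CM k) : HCM k) =
    (X k * (HopfAlgebra.antipode k (δH1 k (n + 1)) : H1CM k) -
    (HopfAlgebra.antipode k (δH1 k (n + 1)) : H1CM k) * X k) -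
    (((n : H1CM k) + 1 : H1CM k) : HCM k) * δ k 1 *
      (HopfAlgebra.antipode k (δH1 k (n + 1)) : H1CM k)
  rw [h1 (n + 1), h1 n, h2, smul_mul_assoc, one_mul, smul_mul_assoc, ← mul_smul_comm, ← comm_Y_antδ,
    antδ, antX, mul_add, ← mul_assoc, ← H1CM_comm (δ_mem 0) (antδ_mem k n), zero_add]
  noncomm_ring

end Antipode

end ConnesMoscovici

/-- The antipode of the Connes-Moscovici Hopf algebra `H¹` on the generators `δₙ`. -/
theorem theorem3 (k : Type*) [Field k] [CharZero k] (n : ℕ) (hn : 1 ≤ n) :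
    HopfAlgebra.antipode k (ConnesMoscovici.δH1 k n) =
      ∑ c : Composition n,
        (((n.factorial : ℚ) / (c.blocks.map fun i => (i.factorial : ℚ)).prod *
          ConnesMoscovici.coeffBeta c.blocks : ℚ) : k) •
        (c.blocks.map (ConnesMoscovici.δH1 k)).prod := by
  let _ := ConnesMoscovici.commRingH1CM k
  -- Acting through `algebraMap ℚ k` makes the rational scalars agree definitionally with the casts
  -- to `k` in the statement.
  let _ : Algebra ℚ (ConnesMoscovici.H1CM k) :=
    Algebra.compHom (ConnesMoscovici.H1CM k) (algebraMap ℚ k)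
  let D : Derivation ℚ (ConnesMoscovici.H1CM k) (ConnesMoscovici.H1CM k) :=
    Derivation.mk'
      { toFun := ConnesMoscovici.adX k
        map_add' := map_add _
        map_smul' := fun c a => map_smul (ConnesMoscovici.adX k) (algebraMap ℚ k c) a }
      (ConnesMoscovici.adX_mul k)
  exact ConnesMoscovici.recursion_solution D (ConnesMoscovici.δH1_zero k)
    (ConnesMoscovici.adX_δH1 k) (s := fun i => HopfAlgebra.antipode k (ConnesMoscovici.δH1 k i))
    (by rw [ConnesMoscovici.δH1_zero, map_zero]) (ConnesMoscovici.antipode_δH1_one k)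
    (ConnesMoscovici.antipode_δH1_add_two k) (Nat.one_le_iff_ne_zero.1 hn)
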